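/- Let $n\ge 1$, let $r=(r_1,\dots,r_n)\in\mathbb Z_{\ge1}^n$, and put $N=r_1+\cdots+r_n$ and $r!=r_1!\cdots r_n!$. Let $B_k$ and $B_k(x)$ be the Bernoulli numbers and polynomials, given by $\frac{ze^{xz}}{e^z-1}=\sum_{k\ge0}B_k(x)\frac{z^k}{k!}$ and $B_k=B_k(0)$. Let $\widetilde B_k$ be the function of period $1$ that agrees with $B_k(x)$ on $[0,1)$, except that $\widetilde B_1(0)=0$. For an integer $q\ge1$ and integers $p_1,\dots,p_{n-1}$ with $\gcd(p_i,q)=1$ for every $i$, define the generalized Dedekind sum $$s_r(q;p_1,\dots,p_{n-1})=\sum_{k_1,\dots,k_{n-1}\in\mathbb Z/q\mathbb Z}\widetilde B_{r_1}\!\left(\tfrac{k_1}{q}\right)\cdots\widetilde B_{r_{n-1}}\!\left(\tfrac{k_{n-1}}{q}\right)\widetilde B_{r_n}\!\left(\tfrac{p_1k_1+\cdots+p_{n-1}k_{n-1}}{q}\right)$$ (so $s_r(q)=\widetilde B_{r_1}(0)$ if $n=1$). Let $d=d_{N,n}$ be the least common multiple of the denominators of the coefficients of the $N$-th Todd polynomial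 in $n$ variables, that is, of the homogeneous part of total degree $N$ of the power series $\prod_{i=1}^n\frac{x_i}{1-e^{-x_i}}$. Then $$\frac{d\,q^{N-n+1}}{r!}\,s_r(q;p_1,\dots,p_{n-1})\in\mathbb Z,$$ and, with $p_n=-1$, $$\frac{d\,q^{N-n+1}}{r!}\,s_r(q;p_1,\dots,p_{n-1})\equiv\sum_{m}(-d)\prod_{i=1}^n\frac{B_{m_i}}{m_i!}\binom{m_i-1}{r_i-1}p_i^{\,m_i-r_i}\pmod q,$$ where the sum is over all $n$-tuples $m=(m_1,\dots,m_n)$ of nonnegative even integers with $m_1+\cdots+m_n=N$ and at least one $m_i=0$. Here $\binom{-1}{k}=(-1)^k$, and for $e<0$ the power $p_i^{e}$ means $(p_i')^{-e}$ for an integer $p_i'$ with $p_ip_i'\equiv1\pmod q$ (with $p_n'=-1$); for every such choice of the $p_i'$ the right-hand side is an integer, and the congruence holds. -/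

import Mathlib

/-- The classical Todd series in one variable, `∑ B_i / i! * (-z)^i`. -/
noncomputable def toddSeries : PowerSeries ℚ :=
  PowerSeries.mk fun i => bernoulli i / (i.factorial : ℚ) * (-1) ^ i

/-- The Todd series is `z / (1 - exp (-z))`. -/
theorem toddSeries_mul :
    toddSeries * (1 - PowerSeries.evalNegHom (PowerSeries.exp ℚ)) = PowerSeries.X := by
  have h1 : toddSeries = PowerSeries.evalNegHom (bernoulliPowerSeries ℚ) := by
    ext i
    simp [toddSeries, bernoulliPowerSeries, PowerSeries.evalNegHom, PowerSeries.coeff_rescale,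
      mul_comm]
  have h2 := congrArg PowerSeries.evalNegHom (bernoulliPowerSeries_mul_exp_sub_one ℚ)
  rw [map_mul, map_sub, map_one, ← h1, PowerSeries.evalNegHom_X] at h2
  rw [← neg_sub, mul_neg, h2, neg_neg]

/-- The `N`-th Todd polynomial in `n` variables: the homogeneous part of total degree `N` of the
power series `∏ i, x_i / (1 - exp (-x_i))`. -/
noncomputable def toddPolynomial (n N : ℕ) : MvPolynomial (Fin n) ℚ :=
  ∑ m ∈ Finset.piAntidiag (Finset.univ : Finset (Fin n)) N,
    MvPolynomial.monomial (Finsupp.equivFunOnFinite.symm m)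
      (∏ i, PowerSeries.coeff (m i) toddSeries)

/-- `d_{N,n}`: the least common multiple of the denominators of the coefficients of the `N`-th Todd
polynomial in `n` variables. -/
noncomputable def toddDenominator (N n : ℕ) : ℕ :=
  (toddPolynomial n N).support.lcm fun m => ((toddPolynomial n N).coeff m).den

/-- The `k`-th periodic Bernoulli function at rational arguments: it has period `1`, and on `[0, 1)`
it equals the Bernoulli polynomial `B_k`, except that the first one vanishes at `0`. -/
noncomputable def periodicBernoulli (k : ℕ) (t : ℚ) : ℚ :=
  if k = 1 ∧ Int.fract t = 0 then 0 else (Polynomial.bernoulli k).eval (Int.fract t)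

/-- The generalized Dedekind sum `s_r(q; p_1, …, p_n)` in dimension `n + 1`. -/
noncomputable def generalizedDedekindSum {n : ℕ} (r : Fin (n + 1) → ℕ) (q : ℕ) (p : Fin n → ℤ) : ℚ :=
  ∑ k : Fin n → Fin q,
    (∏ i : Fin n, periodicBernoulli (r i.castSucc) (((k i : ℕ) : ℚ) / (q : ℚ))) *
      periodicBernoulli (r (Fin.last n))
        ((∑ i : Fin n, (p i : ℚ) * ((k i : ℕ) : ℚ)) / (q : ℚ))

/-- The power `a ^ e` with an integer exponent `e`, where the integer `b` stands for an inverse of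
`a` (modulo some `q`) and is used for negative exponents. -/
def powWithInverse (a b e : ℤ) : ℤ :=
  if 0 ≤ e then a ^ e.toNat else b ^ (-e).toNat

/-- The tuples `(m_1, …, m_n)` of nonnegative even integers with sum `N` and at least one zero
coordinate. -/
def evenIndices (n N : ℕ) : Finset (Fin n → ℕ) :=
  (Finset.piAntidiag Finset.univ N).filter fun m => (∀ i, Even (m i)) ∧ ∃ i, m i = 0

/-! Write `S_q(p; X)` for the sum over `w ^ q = 1` of `∏ i, cothFun (w ^ p_i * exp (X_i z))`, with
`p_n = -1`. The finite Fourier expansion of the Bernoulli functions makes the normalized Dedekind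
sum, up to the factor `d`, the coefficient of `∏ X_i ^ (r_i - 1)` in the part of `S_q` of degree `N
- n` in `z` (`coeff_cothSum`, `dedekindCoeff_eq_generalizedDedekindSum`).

Only residues of `p_i` modulo `q` matter, so take `p_i ≥ 0`. The residue theorem for `cothFun (w ^
q) * ∏ i, cothFun (w ^ p_i * exp (X_i z)) dw / w` gives a reciprocity law (`cothSum_reciprocity`):
`S_q / q` is a boundary term from `w = 0, ∞` minus the sums `S_{p_i} / p_i`, where the weight `p_i`
has become `q` and the linear forms are `X_j - p_j X_i / p_i` for `j ≠ i` and `-q X_i / p_i`. The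
boundary term is zero or a product of cotangents and halves. The expansion coefficients of both are
integer multiples of Todd coefficients, so `d` clears its denominators.

Integrality is tested one prime `ℓ` at a time. Inverse linear forms occur, so the `X_i` are taken
algebraically independent and the test ring is the localization of `ℤ[X]` at `ℓ`, where primitive
linear forms are units. Gauss's lemma returns to individual coefficients. If `ℓ ∤ q`, reducing the
weights modulo `q` and using oddness of the cotangent makes the new moduli smaller than `q` and
either zero or prime to `ℓ`, so reciprocity is a Euclidean descent (`cothSum_mem_integralAt`).

If `ℓ ∣ q`, one reciprocity step is enough (`dedekindCoeff_congr`). All moduli `p_i` are prime to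
`ℓ`, and modulo `q` only the terms with exponent `-1` on `-q X_i / p_i` survive. There the Dedekind
sum degenerates to a product of Bernoulli numbers, and partial fractions (`partial_fractions`) turn
the sum of these terms into Laurent monomials with the stated binomial coefficients. -/

/-! ### Residues and the abstract reciprocity law -/

open Finset Polynomial in
/-- Residue theorem for `G(w) dw / w` with `G = g / f`, all poles being simple: `f` and `g` have
degree at most `D`, and `f` has `D` distinct nonzero roots. -/
theorem sum_eval_div_derivative_eq {L : Type*} [Field L] [DecidableEq L] (s : Finset L)
    (hs : s.Nonempty) (f g : L[X]) (hf : f.natDegree ≤ s.card) (hg : g.natDegree ≤ s.card)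
    (hfs : ∀ a ∈ s, f.eval a = 0) (hc : f.coeff s.card ≠ 0) (hf0 : f.coeff 0 ≠ 0) :
    ∑ a ∈ s, g.eval a / (a * f.derivative.eval a) =
      g.coeff s.card / f.coeff s.card - g.coeff 0 / f.coeff 0 := by
  set c := f.coeff s.card with hcdef
  have hnod : f = C c * Lagrange.nodal s id := by
    refine eq_of_degree_sub_lt_of_eval_finset_eq s ?_ ?_
    · have hn : (Lagrange.nodal s (id : L → L)).natDegree = s.card := Lagrange.natDegree_nodal
      have hco : (Lagrange.nodal s (id : L → L)).coeff s.card = 1 := by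
        have := (Lagrange.nodal_monic (s := s) (v := (id : L → L)))
        rw [Monic, leadingCoeff, hn] at this
        exact this
      rw [degree_lt_iff_coeff_zero]
      intro m hm
      rcases hm.eq_or_lt with rfl | hm
      · rw [coeff_sub, coeff_C_mul, hco, mul_one, sub_self]
      · rw [coeff_sub, coeff_C_mul, coeff_eq_zero_of_natDegree_lt (lt_of_le_of_lt hf hm),
          coeff_eq_zero_of_natDegree_lt (hn.trans_lt hm)]
        simp
    · intro a ha
      rw [hfs a ha, eval_mul]
      have := Lagrange.eval_nodal_at_node (v := (id : L → L)) ha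
      simp only [id] at this
      rw [this, mul_zero]
  have ha0 : ∀ a ∈ s, a ≠ 0 := by
    rintro a ha rfl
    exact hf0 (by rw [coeff_zero_eq_eval_zero, hfs 0 ha])
  have hder : ∀ a ∈ s, f.derivative.eval a = c * ∏ b ∈ s.erase a, (a - b) := by
    intro a ha
    have h := Lagrange.eval_nodal_derivative_eval_node_eq (v := (id : L → L)) ha
    rw [hnod, derivative_mul, derivative_C, zero_mul, zero_add, eval_mul, eval_C]
    simp only [id] at h
    rw [h, Lagrange.eval_nodal]
    simp
  -- Subtracting `k * f` keeps the values of `g` on `s` and removes the pole at `0`. The quotient by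
  -- `X` then has degree below `s.card`, and its top Lagrange coefficient is the sum of residues.
  set k := g.coeff 0 / f.coeff 0 with hk
  set h := divX (g - C k * f) with hh
  have hX : X * h = g - C k * f := by
    have := X_mul_divX_add (g - C k * f)
    have h0 : (g - C k * f).coeff 0 = 0 := by
      rw [coeff_sub, coeff_C_mul, hk]; field_simp; simp
    rw [h0, C_0, add_zero] at this
    exact this
  have hdeg : h.degree < s.card := by
    rw [degree_lt_iff_coeff_zero]
    intro m hm
    rw [hh, coeff_divX, coeff_sub, coeff_C_mul, coeff_eq_zero_of_natDegree_lt (by omega),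
      coeff_eq_zero_of_natDegree_lt (p := f) (by omega)]
    simp
  have key := Lagrange.coeff_eq_sum (v := (id : L → L)) (s := s) Function.injective_id.injOn hdeg
  have hpos : 0 < s.card := hs.card_pos
  rw [hh, coeff_divX, Nat.sub_add_cancel hpos, coeff_sub, coeff_C_mul, ← hcdef] at key
  have : g.coeff s.card / c - k = c⁻¹ * (g.coeff s.card - k * c) := by field_simp
  rw [this, key, mul_sum]
  refine sum_congr rfl fun a ha => ?_
  have e : g.eval a = a * h.eval a := by
    have := congrArg (eval a) hX
    rw [eval_mul, eval_X, eval_sub, eval_mul, hfs a ha, mul_zero, sub_zero] at this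
    exact this.symm
  have hp : ∏ b ∈ s.erase a, (a - b) ≠ 0 := by
    rw [prod_ne_zero_iff]
    intro b hb
    exact sub_ne_zero.2 (ne_of_mem_erase hb).symm
  rw [hder a ha, e, ← hh]
  have := ha0 a ha
  simp only [id]
  field_simp

/-- The hyperbolic cotangent `(u + 1) / (2 (u - 1))`, in the variable `u = exp x`. -/
def cothFun {L : Type*} [Field L] (u : L) : L := (u - 1)⁻¹ + 1 / 2

/-- Oddness of the hyperbolic cotangent. It allows a weight to be replaced by its negative in the
descent. -/
theorem cothFun_inv {L : Type*} [Field L] [CharZero L] (u : L) (h0 : u ≠ 0) (h1 : u ≠ 1) :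
    cothFun u⁻¹ = -cothFun u := by
  have h2 := sub_ne_zero.2 h1
  have h3 : 1 - u ≠ 0 := sub_ne_zero.2 h1.symm
  have : u⁻¹ - 1 = (1 - u) / u := by field_simp
  rw [cothFun, cothFun, this, inv_div, ← neg_sub u 1, div_neg]
  field_simp
  ring

open Finset Polynomial in
theorem coeff_prod_sum_of_natDegree_le {R J : Type*} [CommSemiring R] (s : Finset J)
    (f : J → R[X]) (n : J → ℕ) (h : ∀ j, (f j).natDegree ≤ n j) :
    (∏ j ∈ s, f j).coeff (∑ j ∈ s, n j) = ∏ j ∈ s, (f j).coeff (n j) := by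
  classical
  induction s using Finset.induction_on with
  | empty => simp
  | insert a s ha ih =>
    rw [prod_insert ha, sum_insert ha, prod_insert ha, coeff_mul_add_eq_of_natDegree_le (h a)
      ((natDegree_prod_le _ _).trans (sum_le_sum fun j _ => h j)), ih]

open Finset Polynomial in
/-- Reciprocity: the sum of the residues of `∏ j, cothFun (w ^ P j * u j) dw / w`. -/
theorem reciprocity {L J : Type*} [Field L] [CharZero L] [Fintype J] [DecidableEq J] (P : J → ℕ)
    (u : J → L) (A : J → Finset L) (hu : ∀ j, u j ≠ 0) (hu1 : ∀ j, P j = 0 → u j ≠ 1)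
    (hA : ∀ j, ∀ a ∈ A j, a ^ P j * u j = 1) (hcard : ∀ j, (A j).card = P j)
    (hdis : ∀ i j, i ≠ j → ∀ a ∈ A i, a ^ P j * u j ≠ 1) (hP : ∃ j, P j ≠ 0) :
    ∑ j, (P j : L)⁻¹ * ∑ a ∈ A j, ∏ i ∈ univ.erase j, cothFun (a ^ P i * u i) =
      (∏ j, if P j = 0 then cothFun (u j) else 1 / 2) -
        ∏ j, if P j = 0 then cothFun (u j) else -(1 / 2) := by
  classical
  set s := univ.biUnion A with hs
  have hscard : s.card = ∑ j, P j := by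
    rw [hs, card_biUnion]
    · exact sum_congr rfl fun j _ => hcard j
    · intro i _ j _ hij
      rw [Function.onFun, Finset.disjoint_left]
      intro a hi hj
      exact hdis i j hij a hi (hA j a hj)
  have hsne : s.Nonempty := by
    obtain ⟨j, hj⟩ := hP
    rw [← card_pos, hscard]
    exact lt_of_lt_of_le (Nat.pos_of_ne_zero hj) (single_le_sum (fun _ _ => Nat.zero_le _)
      (mem_univ j))
  -- The `j`-th factor of the integrand is `G j / F j`. Its values at `∞` and `0` are `1 / 2` and
  -- `-1 / 2`, or the constant `cothFun (u j)` when `P j = 0`.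
  let F : J → L[X] := fun j => C (u j) * X ^ P j - 1
  let G : J → L[X] := fun j => C (1 / 2) * (C (u j) * X ^ P j + 1)
  have hFd : ∀ j, (F j).natDegree ≤ P j := fun j => by
    refine (natDegree_sub_le _ _).trans (max_le (natDegree_C_mul_X_pow_le _ _) (by simp))
  have hGd : ∀ j, (G j).natDegree ≤ P j := fun j => by
    refine (natDegree_C_mul_le _ _).trans ((natDegree_add_le _ _).trans
      (max_le (natDegree_C_mul_X_pow_le _ _) (by simp)))
  have hFt : ∀ j, (F j).coeff (P j) = if P j = 0 then u j - 1 else u j := fun j => by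
    by_cases h : P j = 0 <;> simp [F, h, coeff_one]
  have hGt : ∀ j, (G j).coeff (P j) = if P j = 0 then 1 / 2 * (u j + 1) else 1 / 2 * u j :=
    fun j => by
      by_cases h : P j = 0
      · simp [G, h]
      · rw [coeff_C_mul]; simp [h, coeff_one]
  have hF0 : ∀ j, (F j).coeff 0 = if P j = 0 then u j - 1 else -1 := fun j => by
    by_cases h : P j = 0
    · simp [F, h]
    · simp [F, h, coeff_X_pow, Ne.symm h]
  have hG0 : ∀ j, (G j).coeff 0 = if P j = 0 then 1 / 2 * (u j + 1) else 1 / 2 := fun j => by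
    by_cases h : P j = 0
    · simp [G, h]
    · simp [G, h, coeff_X_pow, Ne.symm h]
  have hu1' : ∀ j, P j = 0 → u j - 1 ≠ 0 := fun j h => sub_ne_zero.2 (hu1 j h)
  have hft : (∏ j, F j).coeff s.card = ∏ j, if P j = 0 then u j - 1 else u j := by
    rw [hscard, coeff_prod_sum_of_natDegree_le _ _ _ hFd]
    exact prod_congr rfl fun j _ => hFt j
  have hgt : (∏ j, G j).coeff s.card =
      ∏ j, if P j = 0 then 1 / 2 * (u j + 1) else 1 / 2 * u j := by
    rw [hscard, coeff_prod_sum_of_natDegree_le _ _ _ hGd]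
    exact prod_congr rfl fun j _ => hGt j
  have hf0 : (∏ j, F j).coeff 0 = ∏ j, if P j = 0 then u j - 1 else -1 := by
    rw [coeff_zero_prod]
    exact prod_congr rfl fun j _ => hF0 j
  have hg0 : (∏ j, G j).coeff 0 = ∏ j, if P j = 0 then 1 / 2 * (u j + 1) else 1 / 2 := by
    rw [coeff_zero_prod]
    exact prod_congr rfl fun j _ => hG0 j
  have heF : ∀ j a, (F j).eval a = a ^ P j * u j - 1 := fun j a => by
    simp only [F, eval_mul, eval_C, eval_sub, eval_pow, eval_X, eval_one, mul_comm (u j)]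
  have heG : ∀ j a, (G j).eval a = 1 / 2 * (a ^ P j * u j + 1) := fun j a => by
    simp only [G, eval_mul, eval_C, eval_add, eval_pow, eval_X, eval_one, mul_comm (u j)]
  have hroot : ∀ a ∈ s, (∏ j, F j).eval a = 0 := by
    intro a ha
    obtain ⟨j, -, hj⟩ := mem_biUnion.1 ha
    rw [eval_prod]
    exact prod_eq_zero (mem_univ j) (by rw [heF, hA j a hj, sub_self])
  have key := sum_eval_div_derivative_eq s hsne (∏ j, F j) (∏ j, G j)
    ((natDegree_prod_le _ _).trans (hscard ▸ sum_le_sum fun j _ => hFd j))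
    ((natDegree_prod_le _ _).trans (hscard ▸ sum_le_sum fun j _ => hGd j)) hroot
    (by
      rw [hft, prod_ne_zero_iff]
      intro j _
      split_ifs with h
      exacts [hu1' j h, hu j])
    (by
      rw [hf0, prod_ne_zero_iff]
      intro j _
      split_ifs with h
      exacts [hu1' j h, by simp])
  rw [hft, hgt, hf0, hg0, ← prod_div_distrib, ← prod_div_distrib] at key
  have hcf : ∀ v : L, v - 1 ≠ 0 → cothFun v = 1 / 2 * (v + 1) / (v - 1) := fun v hv => by
    rw [cothFun]; field_simp; ring
  convert key using 1
  · rw [hs, sum_biUnion]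
    · refine sum_congr rfl fun j _ => ?_
      rw [mul_sum]
      refine sum_congr rfl fun a ha => ?_
      have hPj : P j ≠ 0 := by
        rintro h
        rw [card_eq_zero.1 ((hcard j).trans h)] at ha
        simp at ha
      have h1 := hA j a ha
      have ha0 : a ≠ 0 := by
        rintro rfl
        simp [hPj] at h1
      rw [eval_prod, ← mul_prod_erase univ _ (mem_univ j), heG, h1,
        ← mul_prod_erase univ F (mem_univ j), derivative_mul, eval_add, eval_mul, eval_mul,
        heF, h1, sub_self, zero_mul, add_zero, eval_prod]
      -- Since `a ^ P j * u j = 1` and `G j` takes the value `1` at `a`, the `j`-th factor alone has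
      -- residue `1 / P j`.
      have hd : a * eval a (derivative (F j)) = P j := by
        simp only [F, derivative_sub, derivative_C_mul_X_pow, derivative_one, sub_zero, eval_mul,
          eval_C, eval_pow, eval_X]
        obtain ⟨m, hm⟩ := Nat.exists_eq_succ_of_ne_zero hPj
        rw [hm] at h1 ⊢
        rw [pow_succ] at h1
        simp only [Nat.succ_eq_add_one, Nat.add_sub_cancel]
        linear_combination ((m + 1 : ℕ) : L) * h1
      rw [← mul_assoc, hd, show (1 / 2 : L) * (1 + 1) = 1 by norm_num, one_mul, mul_comm (P j : L),
        ← div_div, ← prod_div_distrib, div_eq_mul_inv, mul_comm]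
      congr 1
      refine prod_congr rfl fun i hi => ?_
      rw [heG, heF, hcf _ (sub_ne_zero.2 (hdis j i (ne_of_mem_erase hi).symm a ha))]
    · intro i _ j _ hij
      rw [Function.onFun, Finset.disjoint_left]
      intro a hi hj
      exact hdis i j hij a hi (hA j a hj)
  · congr 1
    · refine prod_congr rfl fun j _ => ?_
      split_ifs with h
      · rw [hcf _ (hu1' j h)]
      · have := hu j
        field_simp
    · refine prod_congr rfl fun j _ => ?_
      split_ifs with h
      · rw [hcf _ (hu1' j h)]
      · simp [div_neg]

/-! ### Finite Fourier expansion of the Bernoulli functions -/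

/-- The weight of the residue `k` in the finite Fourier expansion of the Bernoulli functions. -/
noncomputable def bernoulliWeight (Q r k : ℕ) : ℚ :=
  (Q : ℚ) ^ ((r : ℤ) - 1) * (periodicBernoulli r ((k : ℚ) / Q) / r.factorial)

/-- The finite Fourier transform of the Bernoulli functions. -/
noncomputable def bernoulliFourier {K : Type*} [Field K] (Q r : ℕ) (w : K) : K :=
  ∑ k ∈ Finset.range Q, w ^ k * (bernoulliWeight Q r k : K)

-- This is the generating function of the Bernoulli polynomials at `k / Q`, rescaled by `Q`. The
-- extra term at `k = 0` accounts for the first Bernoulli function being `0` instead of `-1 / 2`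
-- there.
open PowerSeries in
theorem periodicBernoulli_generating_function (K : Type*) [Field K] [CharZero K] {Q k : ℕ}
    (hk : k < Q) :
    (mk fun r => (((Q : ℚ) ^ r * (periodicBernoulli r ((k : ℚ) / Q) / r.factorial) : ℚ) : K)) *
        (rescale (Q : K) (exp K) - 1) =
      C (Q : K) * X * exp K ^ k +
        if k = 0 then C ((Q : K) / 2) * X * (rescale (Q : K) (exp K) - 1) else 0 := by
  have hQ : (Q : ℚ) ≠ 0 := by exact_mod_cast (Nat.zero_le k).trans_lt hk |>.ne'
  have hQK : (Q : K) ≠ 0 := by exact_mod_cast (Nat.zero_le k).trans_lt hk |>.ne'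
  have hfr : Int.fract ((k : ℚ) / Q) = (k : ℚ) / Q := by
    rw [Int.fract_eq_self]
    refine ⟨by positivity, ?_⟩
    rw [div_lt_one (by positivity)]
    exact_mod_cast hk
  have h := congrArg (rescale (Q : K))
    (Polynomial.bernoulli_generating_function (A := K) ((k : K) / Q))
  rw [map_mul, map_mul, map_sub, map_one, rescale_rescale, rescale_X, div_mul_cancel₀ _ hQK,
    ← exp_pow_eq_rescale_exp k] at h
  rw [← h]
  have : (mk fun r => (((Q : ℚ) ^ r * (periodicBernoulli r ((k : ℚ) / Q) / r.factorial) : ℚ) : K))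
      = (rescale (Q : K) (mk fun n => Polynomial.aeval ((k : K) / Q)
        ((1 / (n.factorial : ℚ)) • Polynomial.bernoulli n))) +
        if k = 0 then C ((Q : K) / 2) * X else 0 := by
    ext r
    have hae : Polynomial.aeval ((k : K) / Q)
        ((1 / (r.factorial : ℚ)) • Polynomial.bernoulli r) =
        (((Polynomial.bernoulli r).eval ((k : ℚ) / Q) / r.factorial : ℚ) : K) := by
      have e : ((k : K) / Q) = algebraMap ℚ K ((k : ℚ) / Q) := by simp
      rw [e, Polynomial.aeval_algebraMap_apply, Polynomial.aeval_def, eq_ratCast]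
      congr 1
      simp [div_eq_inv_mul]
    rw [coeff_mk, map_add, coeff_rescale, coeff_mk, hae, periodicBernoulli, hfr]
    by_cases h0 : k = 0
    · subst h0
      by_cases h1 : r = 1
      · subst h1
        simp [coeff_succ_mul_X, Polynomial.bernoulli_one]
        ring
      · have : coeff r (C ((Q : K) / 2) * X) = 0 := by
          rw [coeff_C_mul, coeff_X, if_neg h1, mul_zero]
        simp [h1, this]
    · have h2 : ¬ ((k : ℚ) / Q = 0) := by
        simp [h0, hQ]
      simp [h0, h2]
  rw [this, add_mul]
  congr 1
  split_ifs <;> simp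

/-- Summing over `k` gives a geometric series in `w * exp z`. Because `w ^ Q = 1`, its numerator is
`exp (Q z) - 1`, which cancels the common denominator and leaves `z / (w * exp z - 1)`. The
correction at `k = 0` supplies the summand `z / 2` of `z * cothFun (w * exp z)`. -/
theorem bernoulliFourier_generating_function {K : Type*} [Field K] [CharZero K] {Q : ℕ}
    (hQ : 0 < Q) {w : K} (hw : w ^ Q = 1) :
    (PowerSeries.mk fun r => bernoulliFourier Q r w) *
        (PowerSeries.C w * PowerSeries.exp K - 1) =
      PowerSeries.C (1 / 2) * PowerSeries.X * (PowerSeries.C w * PowerSeries.exp K + 1) := by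
  open PowerSeries in
  have hQK : (Q : K) ≠ 0 := by exact_mod_cast hQ.ne'
  have hQQ : (Q : ℚ) ≠ 0 := by exact_mod_cast hQ.ne'
  set e := exp K with he
  set eQ := rescale (Q : K) e - 1 with heQ
  have heQ0 : eQ ≠ 0 := by
    intro h
    have := congrArg (coeff 1) h
    simp [heQ, he, coeff_rescale, coeff_one] at this
    exact hQ.ne' this
  have hsum : C (Q : K) * (mk fun r => bernoulliFourier Q r w) =
      ∑ k ∈ Finset.range Q, C (w ^ k) * (mk fun r =>
        (((Q : ℚ) ^ r * (periodicBernoulli r ((k : ℚ) / Q) / r.factorial) : ℚ) : K)) := by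
    ext r
    simp only [coeff_C_mul, coeff_mk, map_sum, bernoulliFourier, Finset.mul_sum]
    refine Finset.sum_congr rfl fun k _ => ?_
    rw [bernoulliWeight, zpow_sub_one₀ hQQ, zpow_natCast]
    push_cast
    field_simp
  have hpow : (C w * e) ^ Q - 1 = eQ := by
    rw [mul_pow, ← map_pow, hw, map_one, one_mul, heQ, he, exp_pow_eq_rescale_exp]
  have hgeom := geom_sum_mul (C w * e) Q
  rw [hpow] at hgeom
  have h1 : C (Q : K) * (mk fun r => bernoulliFourier Q r w) * eQ =
      C (Q : K) * X * (∑ k ∈ Finset.range Q, (C w * e) ^ k) + C ((Q : K) / 2) * X * eQ := by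
    rw [hsum, Finset.sum_mul, Finset.mul_sum]
    have : ∀ k ∈ Finset.range Q, C (w ^ k) * (mk fun r =>
        (((Q : ℚ) ^ r * (periodicBernoulli r ((k : ℚ) / Q) / r.factorial) : ℚ) : K)) * eQ =
        C (Q : K) * X * (C w * e) ^ k + if k = 0 then C ((Q : K) / 2) * X * eQ else 0 := by
      intro k hk
      rw [mul_assoc, heQ, he, periodicBernoulli_generating_function K (Finset.mem_range.1 hk),
        mul_add]
      congr 1
      · rw [mul_pow, map_pow]; ring
      · split_ifs with h
        · simp [h]
        · simp
    rw [Finset.sum_congr rfl this, Finset.sum_add_distrib, Finset.sum_ite_eq' (Finset.range Q) 0,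
      if_pos (Finset.mem_range.2 hQ)]
  have hC : C ((Q : K) / 2) = C (Q : K) * C (1 / 2 : K) := by rw [← map_mul]; congr 1; ring
  have h2 : (C (1 / 2) : K⟦X⟧) + C (1 / 2) = 1 := by rw [← map_add]; norm_num
  have hCQ : (C (Q : K) : K⟦X⟧) ≠ 0 :=
    (map_ne_zero_iff _ C_injective).2 hQK
  refine mul_left_cancel₀ heQ0 (mul_left_cancel₀ hCQ ?_)
  rw [hC] at h1
  linear_combination (C w * e - 1) * h1 + C (Q : K) * X * hgeom +
    -(C (Q : K) * X * eQ) * h2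

/-! ### Exponentials and cotangents as Laurent series -/

open HahnSeries in
/-- The exponential `exp (x z)` as a Laurent series in `z`. -/
noncomputable def expLaurent {K : Type*} [Field K] [CharZero K] (x : K) : LaurentSeries K :=
  ofPowerSeries ℤ K (PowerSeries.rescale x (PowerSeries.exp K))

section
variable {K : Type*} [Field K] [CharZero K]

instance : CharZero (LaurentSeries K) :=
  charZero_of_injective_algebraMap (algebraMap K _).injective

theorem expLaurent_add (x y : K) : expLaurent (x + y) = expLaurent x * expLaurent y := by
  rw [expLaurent, expLaurent, expLaurent, ← map_mul, PowerSeries.exp_mul_exp_eq_exp_add]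

@[simp] theorem expLaurent_zero : expLaurent (0 : K) = 1 := by
  rw [expLaurent, PowerSeries.rescale_zero]
  simp

theorem expLaurent_nsmul (n : ℕ) (x : K) : expLaurent (n * x) = expLaurent x ^ n := by
  induction n with
  | zero => simp
  | succ n ih => rw [pow_succ, ← ih, ← expLaurent_add]; congr 1; push_cast; ring

theorem expLaurent_ne_zero (x : K) : expLaurent x ≠ 0 := by
  intro h
  have := expLaurent_add x (-x)
  rw [h, zero_mul, add_neg_cancel, expLaurent_zero] at this
  exact one_ne_zero this

theorem expLaurent_neg (x : K) : expLaurent (-x) = (expLaurent x)⁻¹ :=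
  eq_inv_of_mul_eq_one_left (by rw [← expLaurent_add, neg_add_cancel, expLaurent_zero])

/-- The coefficient of `z` is `w * x`, which is nonzero. This is what separates the poles of
different factors in the residue theorem. -/
theorem C_mul_expLaurent_ne_one {w x : K} (hw : w ≠ 0) (hx : x ≠ 0) :
    HahnSeries.C w * expLaurent x ≠ 1 := by
  intro h
  rw [expLaurent, ← HahnSeries.ofPowerSeries_C (Γ := ℤ), ← map_mul, ← map_one
    (HahnSeries.ofPowerSeries ℤ K)] at h
  have := congrArg (PowerSeries.coeff 1) (HahnSeries.ofPowerSeries_injective h)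
  simp [PowerSeries.coeff_rescale, PowerSeries.coeff_one, hw, hx] at this

/-- The expansion of `z * cothFun (w * exp (x z))` at `z = 0`, for a root of unity `w`. -/
theorem single_mul_cothFun {Q : ℕ} (hQ : 0 < Q) {w x : K} (hw : w ^ Q = 1) (hx : x ≠ 0) :
    HahnSeries.single (1 : ℤ) (1 : K) * cothFun (HahnSeries.C w * expLaurent x) =
      HahnSeries.ofPowerSeries ℤ K
        (PowerSeries.mk fun r => bernoulliFourier Q r w * x ^ ((r : ℤ) - 1)) := by
  have hw0 : w ≠ 0 := by
    rintro rfl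
    rw [zero_pow hQ.ne'] at hw
    exact zero_ne_one hw
  open PowerSeries in
  have h := congrArg (rescale x) (bernoulliFourier_generating_function hQ hw)
  have hb : PowerSeries.rescale x (PowerSeries.mk fun r => bernoulliFourier Q r w) =
      PowerSeries.C x * PowerSeries.mk fun r => bernoulliFourier Q r w * x ^ ((r : ℤ) - 1) := by
    ext r
    rw [PowerSeries.coeff_rescale, PowerSeries.coeff_mk, PowerSeries.coeff_C_mul,
      PowerSeries.coeff_mk, zpow_sub_one₀ hx, zpow_natCast]
    field_simp
  have hCr : ∀ a : K, PowerSeries.rescale x (PowerSeries.C a) = PowerSeries.C a := fun a => by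
    ext r
    rw [PowerSeries.coeff_rescale, PowerSeries.coeff_C]
    split_ifs with h <;> simp [h]
  simp only [map_mul, map_sub, map_add, map_one, hb, hCr, PowerSeries.rescale_X] at h
  set p := PowerSeries.mk fun r => bernoulliFourier Q r w * x ^ ((r : ℤ) - 1)
  have hCx : (PowerSeries.C x : PowerSeries K) ≠ 0 := by simpa using hx
  have h' : p * (PowerSeries.C w * PowerSeries.rescale x (PowerSeries.exp K) - 1) =
      PowerSeries.C (1 / 2) * PowerSeries.X *
        (PowerSeries.C w * PowerSeries.rescale x (PowerSeries.exp K) + 1) := by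
    refine mul_left_cancel₀ hCx ?_
    linear_combination h
  have h2 := congrArg (HahnSeries.ofPowerSeries ℤ K) h'
  simp only [map_mul, map_sub, map_add, map_one, HahnSeries.ofPowerSeries_C,
    HahnSeries.ofPowerSeries_X] at h2
  rw [← expLaurent] at h2
  have hne := sub_ne_zero.2 (C_mul_expLaurent_ne_one hw0 hx)
  have h12 : (HahnSeries.C (1 / 2 : K) : LaurentSeries K) = 1 / 2 := by
    rw [map_div₀, map_one, map_ofNat]
  have h11 : (1 / 2 : LaurentSeries K) + 1 / 2 = 1 := by
    rw [← h12, ← map_add, add_halves, map_one]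
  rw [h12] at h2
  refine mul_right_cancel₀ hne ?_
  rw [h2, cothFun, mul_assoc, add_mul, inv_mul_cancel₀ hne]
  linear_combination -HahnSeries.single (1 : ℤ) (1 : K) * h11

end

/-! ### Cotangent sums, Dedekind sums and their reciprocity -/

section
variable {K : Type*} [Field K] [CharZero K] {ι : Type*} [Fintype ι]

/-- The sum of `∏ i, cothFun (w ^ P i * exp (X i * z))` over the `Q`-th roots of unity `w`. -/
noncomputable def cothSum (Q : ℕ) (P : ι → ℕ) (X : ι → K) : LaurentSeries K :=
  ∑ w ∈ Polynomial.nthRootsFinset Q (1 : K),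
    ∏ i, cothFun (HahnSeries.C (w ^ P i) * expLaurent (X i))

/-- The generalized Dedekind sum of modulus `Q` and weights `P`, in symmetric form and normalized
as the coefficient of `cothSum`. -/
noncomputable def dedekindCoeff [DecidableEq ι] (Q : ℕ) (P : ι → ℕ) (r : ι → ℕ) : ℚ :=
  Q * ∑ k : ι → Fin Q, if Q ∣ ∑ i, P i * (k i : ℕ) then ∏ i, bernoulliWeight Q (r i) (k i) else 0

theorem Finset.sum_piAntidiag_eq_sum_finsuppAntidiag {M : Type*} [AddCommMonoid M] [DecidableEq ι]
    (f : (ι → ℕ) → M) (N : ℕ) :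
    ∑ m ∈ piAntidiag univ N, f m = ∑ m ∈ finsuppAntidiag (univ : Finset ι) N, f m := by
  refine sum_nbij' (fun m => Finsupp.equivFunOnFinite.symm m) (fun m => m) ?_ ?_ ?_ ?_ ?_
  · intro m hm
    simpa using hm
  · intro m hm
    simpa using hm
  · intro m _
    rfl
  · intro m _
    ext; rfl
  · intro m _
    rfl

omit [CharZero K] in
/-- The coefficients of a product of Laurent series with at most simple poles. -/
theorem coeff_prod_of_single_mul [DecidableEq ι] (g : ι → LaurentSeries K) (F : ι → PowerSeries K)
    (h : ∀ i, HahnSeries.single (1 : ℤ) (1 : K) * g i = HahnSeries.ofPowerSeries ℤ K (F i))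
    (N : ℕ) :
    (∏ i, g i).coeff ((N : ℤ) - Fintype.card ι) =
      ∑ m ∈ Finset.piAntidiag Finset.univ N, ∏ i, PowerSeries.coeff (m i) (F i) := by
  have h1 : HahnSeries.single (Fintype.card ι : ℤ) (1 : K) * ∏ i, g i =
      HahnSeries.ofPowerSeries ℤ K (∏ i, F i) := by
    rw [map_prod, ← Finset.prod_congr rfl fun i _ => h i, Finset.prod_mul_distrib,
      Finset.prod_const, HahnSeries.single_pow]
    simp
  have h2 := congrArg (fun f => HahnSeries.coeff f (N : ℤ)) h1
  simp only [HahnSeries.coeff_single_mul, one_mul, HahnSeries.ofPowerSeries_apply_coeff] at h2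
  rw [h2, PowerSeries.coeff_prod, Finset.sum_piAntidiag_eq_sum_finsuppAntidiag]

theorem exists_isPrimitiveRoot (K : Type*) [Field K] [CharZero K] [IsAlgClosed K] {Q : ℕ}
    (hQ : 0 < Q) : ∃ ζ : K, IsPrimitiveRoot ζ Q := by
  have : NeZero (Q : K) := ⟨by exact_mod_cast hQ.ne'⟩
  exact HasEnoughRootsOfUnity.exists_primitiveRoot K Q

variable [IsAlgClosed K]

theorem card_nthRootsFinset_one (Q : ℕ) : (Polynomial.nthRootsFinset Q (1 : K)).card = Q := by
  rcases Q.eq_zero_or_pos with rfl | hQ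
  · simp
  · obtain ⟨ζ, hζ⟩ := exists_isPrimitiveRoot K hQ
    exact hζ.card_nthRootsFinset

theorem sum_pow_nthRootsFinset {Q : ℕ} (hQ : 0 < Q) (m : ℕ) :
    ∑ w ∈ Polynomial.nthRootsFinset Q (1 : K), w ^ m = if Q ∣ m then (Q : K) else 0 := by
  split_ifs with h
  · obtain ⟨c, rfl⟩ := h
    rw [Finset.sum_congr rfl (g := fun _ => (1 : K)), Finset.sum_const, card_nthRootsFinset_one,
      nsmul_eq_mul, mul_one]
    intro w hw
    rw [Polynomial.mem_nthRootsFinset hQ] at hw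
    rw [pow_mul, hw, one_pow]
  · obtain ⟨ζ, hζ⟩ := exists_isPrimitiveRoot K hQ
    have hne : ζ ^ m ≠ 1 := fun h1 => h ((hζ.pow_eq_one_iff_dvd m).1 h1)
    have hζ0 : ζ ≠ 0 := hζ.ne_zero hQ.ne'
    have : ∑ w ∈ Polynomial.nthRootsFinset Q (1 : K), w ^ m =
        ζ ^ m * ∑ w ∈ Polynomial.nthRootsFinset Q (1 : K), w ^ m := by
      rw [Finset.mul_sum]
      refine Finset.sum_nbij' (fun w => ζ⁻¹ * w) (fun w => ζ * w) ?_ ?_ ?_ ?_ ?_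
      · intro w hw
        rw [Polynomial.mem_nthRootsFinset hQ] at hw ⊢
        rw [mul_pow, inv_pow, hζ.pow_eq_one, hw, inv_one, one_mul]
      · intro w hw
        rw [Polynomial.mem_nthRootsFinset hQ] at hw ⊢
        rw [mul_pow, hζ.pow_eq_one, hw, one_mul]
      · intro w _
        exact mul_inv_cancel_left₀ hζ0 w
      · intro w _
        exact inv_mul_cancel_left₀ hζ0 w
      · intro w _
        rw [← mul_pow, mul_inv_cancel_left₀ hζ0]
    have h2 : (1 - ζ ^ m) * ∑ w ∈ Polynomial.nthRootsFinset Q (1 : K), w ^ m = 0 := by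
      linear_combination this
    exact (mul_eq_zero.1 h2).resolve_left (sub_ne_zero.2 hne.symm)

/-- After expanding the product, orthogonality of the roots of unity keeps only the tuples with `Q ∣
∑ i, P i * k i`. -/
theorem sum_prod_bernoulliFourier [DecidableEq ι] {Q : ℕ} (hQ : 0 < Q) (P r : ι → ℕ) :
    ∑ w ∈ Polynomial.nthRootsFinset Q (1 : K), ∏ i, bernoulliFourier Q (r i) (w ^ P i) =
      (dedekindCoeff Q P r : K) := by
  have h : ∀ w : K, ∏ i, bernoulliFourier Q (r i) (w ^ P i) =
      ∑ k : ι → Fin Q, w ^ (∑ i, P i * (k i : ℕ)) *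
        ((∏ i, bernoulliWeight Q (r i) (k i) : ℚ) : K) := by
    intro w
    simp only [bernoulliFourier, Finset.sum_range]
    rw [Finset.prod_univ_sum, Fintype.piFinset_univ]
    refine Finset.sum_congr rfl fun k _ => ?_
    rw [Finset.prod_mul_distrib, ← Finset.prod_pow_eq_pow_sum]
    push_cast
    congr 1
    exact Finset.prod_congr rfl fun i _ => (pow_mul _ _ _).symm
  rw [Finset.sum_congr rfl fun w _ => h w, Finset.sum_comm, dedekindCoeff]
  push_cast
  rw [Finset.mul_sum]
  refine Finset.sum_congr rfl fun k _ => ?_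
  rw [← Finset.sum_mul, sum_pow_nthRootsFinset hQ]
  split_ifs <;> simp

theorem coeff_cothSum [DecidableEq ι] {Q : ℕ} (hQ : 0 < Q) (P : ι → ℕ) (X : ι → K)
    (hX : ∀ i, X i ≠ 0) (N : ℕ) :
    (cothSum Q P X).coeff ((N : ℤ) - Fintype.card ι) =
      ∑ r ∈ Finset.piAntidiag Finset.univ N,
        (dedekindCoeff Q P r : K) * ∏ i, X i ^ ((r i : ℤ) - 1) := by
  rw [cothSum, HahnSeries.coeff_sum, Finset.sum_congr rfl fun w hw =>
    coeff_prod_of_single_mul _ _ (fun i => single_mul_cothFun hQ (w := w ^ P i) (by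
      rw [Polynomial.mem_nthRootsFinset hQ] at hw
      rw [← pow_mul, mul_comm, pow_mul, hw, one_pow]) (hX i)) N, Finset.sum_comm]
  refine Finset.sum_congr rfl fun r _ => ?_
  rw [← sum_prod_bernoulliFourier hQ, Finset.sum_mul]
  refine Finset.sum_congr rfl fun w _ => ?_
  simp only [PowerSeries.coeff_mk, Finset.prod_mul_distrib]

theorem prod_univ_erase_some {M : Type*} [CommMonoid M] [DecidableEq ι] (f : Option ι → M)
    (i : ι) :
    ∏ j ∈ Finset.univ.erase (some i), f j = ∏ j, if j = i then f none else f (some j) := by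
  symm
  refine Finset.prod_bij (fun j _ => if j = i then none else some j) ?_ ?_ ?_ ?_
  · intro j _
    by_cases h : j = i <;> simp [h]
  · intro j _ k _ h
    by_cases h1 : j = i <;> by_cases h2 : k = i <;> simp_all
  · intro o ho
    rcases o with _ | j
    · exact ⟨i, Finset.mem_univ _, by simp⟩
    · exact ⟨j, Finset.mem_univ _, by simpa using ho⟩
  · intro j _
    by_cases h : j = i <;> simp [h]

/-- The linear forms at the poles of the `i`-th factor of `cothSum Q P X`. -/
noncomputable def reciprocalForms [DecidableEq ι] (Q : ℕ) (P : ι → ℕ) (X : ι → K) (i : ι) :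
    ι → K :=
  Function.update (fun j => X j - P j * X i / P i) i (-(Q * X i / P i))

omit [Fintype ι] [IsAlgClosed K] in
theorem expLaurent_pow_mul (w x y : K) (m : ℕ) :
    (HahnSeries.C w * expLaurent y) ^ m * expLaurent x =
      HahnSeries.C (w ^ m) * expLaurent (x + m * y) := by
  rw [mul_pow, ← expLaurent_nsmul, mul_assoc, ← expLaurent_add, map_pow, add_comm]

/-- This is `reciprocity` with one more factor `cothFun (w ^ Q)`, indexed by `none`. The poles of
factor `i` are `w * exp (-X i z / P i)` with `w ^ P i = 1`; substituting them into the other factors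
produces `reciprocalForms`. The hypothesis `hXX` keeps all poles simple. -/
theorem cothSum_reciprocity [DecidableEq ι] {Q : ℕ} (hQ : 0 < Q) (P : ι → ℕ) (X : ι → K)
    (hX : ∀ i, X i ≠ 0) (hXX : ∀ i j, i ≠ j → P i ≠ 0 → X j - P j * X i / P i ≠ 0) :
    (Q : LaurentSeries K)⁻¹ * cothSum Q P X +
        ∑ i, (P i : LaurentSeries K)⁻¹ *
          cothSum (P i) (Function.update P i Q) (reciprocalForms Q P X i) =
      1 / 2 * ((∏ i, if P i = 0 then cothFun (expLaurent (X i)) else 1 / 2) +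
        ∏ i, if P i = 0 then cothFun (expLaurent (X i)) else -(1 / 2)) := by
  classical
  let P' : Option ι → ℕ := fun o => o.elim Q P
  let u : Option ι → LaurentSeries K := fun o => o.elim 1 fun i => expLaurent (X i)
  -- The poles of factor `o` are the `P' o`-th roots of unity times `exp (y o * z)`.
  let y : Option ι → K := fun o => o.elim 0 fun i => -(X i / P i)
  let A : Option ι → Finset (LaurentSeries K) := fun o =>
    (Polynomial.nthRootsFinset (P' o) (1 : K)).image fun w => HahnSeries.C w * expLaurent (y o)
  have hinj : ∀ x : K, Function.Injective fun w : K =>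
      (HahnSeries.C w * expLaurent x : LaurentSeries K) := fun x a b h =>
    HahnSeries.C_injective (mul_right_cancel₀ (expLaurent_ne_zero x) h)
  have hmem : ∀ o a, a ∈ A o → P' o ≠ 0 ∧ ∃ w : K, w ≠ 0 ∧ w ^ P' o = 1 ∧
      a = HahnSeries.C w * expLaurent (y o) := by
    intro o a ha
    obtain ⟨w, hw, rfl⟩ := Finset.mem_image.1 ha
    have h0 : P' o ≠ 0 := by
      intro h
      rw [h] at hw
      simp at hw
    rw [Polynomial.mem_nthRootsFinset (Nat.pos_of_ne_zero h0)] at hw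
    refine ⟨h0, w, ?_, hw, rfl⟩
    rintro rfl
    rw [zero_pow h0] at hw
    exact zero_ne_one hw
  have hPK : ∀ i, P i ≠ 0 → (P i : K) ≠ 0 := fun i h => by exact_mod_cast h
  have hQK : (Q : K) ≠ 0 := by exact_mod_cast hQ.ne'
  have hu1 : (1 : LaurentSeries K) = expLaurent 0 := expLaurent_zero.symm
  have key := reciprocity P' u A
    (by
      rintro (_ | i)
      · exact one_ne_zero
      · exact expLaurent_ne_zero _)
    (by
      rintro (_ | i) h
      · exact absurd h hQ.ne'
      · have := C_mul_expLaurent_ne_one (one_ne_zero (α := K)) (hX i)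
        rwa [map_one, one_mul] at this)
    (by
      rintro (_ | i) a ha
      · obtain ⟨-, w, -, hw, rfl⟩ := hmem _ a ha
        simp only [P', u, y, Option.elim] at hw ⊢
        rw [hu1, expLaurent_pow_mul, hw]
        simp
      · obtain ⟨h0, w, -, hw, rfl⟩ := hmem _ a ha
        simp only [P', u, y, Option.elim] at hw h0 ⊢
        have := hPK i h0
        rw [expLaurent_pow_mul, hw, show X i + P i * -(X i / P i) = 0 by field_simp; ring]
        simp)
    (by
      intro o
      rw [Finset.card_image_of_injective _ (hinj _), card_nthRootsFinset_one])
    (by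
      rintro (_ | i) (_ | j) hij a ha
      · exact absurd rfl hij
      · obtain ⟨-, w, hw0, -, rfl⟩ := hmem _ a ha
        simp only [P', u, y, Option.elim]
        rw [expLaurent_pow_mul]
        exact C_mul_expLaurent_ne_one (pow_ne_zero _ hw0) (by simpa using hX j)
      · obtain ⟨h0, w, hw0, -, rfl⟩ := hmem _ a ha
        simp only [P', u, y, Option.elim] at h0 ⊢
        rw [← expLaurent_zero, expLaurent_pow_mul, expLaurent_zero]
        refine C_mul_expLaurent_ne_one (pow_ne_zero _ hw0) ?_
        rw [zero_add]
        exact mul_ne_zero hQK (neg_ne_zero.2 (div_ne_zero (hX i) (hPK i h0)))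
      · obtain ⟨h0, w, hw0, -, rfl⟩ := hmem _ a ha
        simp only [P', u, y, Option.elim] at h0 ⊢
        rw [expLaurent_pow_mul]
        refine C_mul_expLaurent_ne_one (pow_ne_zero _ hw0) ?_
        convert hXX i j (fun h => hij (congrArg some h)) h0 using 1
        ring)
    ⟨none, hQ.ne'⟩
  rw [Fintype.sum_option, Fintype.prod_option, Fintype.prod_option] at key
  simp only [P', Option.elim, hQ.ne', if_false, u] at key
  have e0 : ∑ a ∈ A none, ∏ j ∈ Finset.univ.erase none, cothFun (a ^ P' j * u j) =
      cothSum Q P X := by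
    rw [Finset.sum_image fun _ _ _ _ h => hinj _ h, cothSum]
    refine Finset.sum_congr rfl fun w _ => ?_
    have : (Finset.univ.erase none : Finset (Option ι)) =
        Finset.univ.map Function.Embedding.some := by
      ext o
      cases o <;> simp
    rw [this, Finset.prod_map]
    refine Finset.prod_congr rfl fun i _ => ?_
    simp only [P', u, y, Option.elim, Function.Embedding.some_apply]
    rw [expLaurent_pow_mul]
    simp
  have e1 : ∀ i, ∑ a ∈ A (some i), ∏ j ∈ Finset.univ.erase (some i), cothFun (a ^ P' j * u j) =
      cothSum (P i) (Function.update P i Q) (reciprocalForms Q P X i) := by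
    intro i
    rw [Finset.sum_image fun _ _ _ _ h => hinj _ h, cothSum]
    refine Finset.sum_congr rfl fun w _ => ?_
    rw [prod_univ_erase_some]
    refine Finset.prod_congr rfl fun j _ => ?_
    by_cases hj : j = i
    · subst hj
      simp only [P', u, y, Option.elim, if_true, reciprocalForms, Function.update_self]
      rw [hu1, expLaurent_pow_mul]
      congr 3
      ring
    · simp only [P', u, y, Option.elim, hj, if_false, reciprocalForms, ne_eq, not_false_eq_true,
        Function.update_of_ne]
      rw [expLaurent_pow_mul]
      congr 3
      ring
  set a := ∏ i, if P i = 0 then cothFun (expLaurent (X i)) else (1 / 2 : LaurentSeries K)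
  set b := ∏ i, if P i = 0 then cothFun (expLaurent (X i)) else -(1 / 2 : LaurentSeries K)
  have key' : (Q : LaurentSeries K)⁻¹ * ∑ a ∈ A none, ∏ j ∈ Finset.univ.erase none,
      cothFun (a ^ P' j * u j) + ∑ i, (P i : LaurentSeries K)⁻¹ * ∑ a ∈ A (some i),
        ∏ j ∈ Finset.univ.erase (some i), cothFun (a ^ P' j * u j) =
      1 / 2 * a - -(1 / 2) * b := key
  simp only [e0, e1] at key'
  rw [key']
  ring

end

/-! ### Integrality at a prime not dividing the modulus -/

/-- The coefficient of `z ^ m` in `z * cothFun (exp z)`. -/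
noncomputable def cothCoeff (m : ℕ) : ℚ := periodicBernoulli m 0 / m.factorial

section
variable {K : Type*} [Field K] [CharZero K] {ι : Type*} [Fintype ι]

theorem bernoulliFourier_one_one (m : ℕ) : bernoulliFourier 1 m (1 : K) = cothCoeff m := by
  simp [bernoulliFourier, bernoulliWeight, cothCoeff]

theorem single_mul_cothFun_expLaurent {x : K} (hx : x ≠ 0) :
    HahnSeries.single (1 : ℤ) (1 : K) * cothFun (expLaurent x) =
      HahnSeries.ofPowerSeries ℤ K
        (PowerSeries.mk fun m => (cothCoeff m : K) * x ^ ((m : ℤ) - 1)) := by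
  simpa [bernoulliFourier_one_one] using
    single_mul_cothFun one_pos (one_pow 1 : (1 : K) ^ 1 = 1) hx

/-- `y` is a unit of the subring `O`. -/
def IsUnitIn (O : Subring K) (y : K) : Prop := y ≠ 0 ∧ y ∈ O ∧ y⁻¹ ∈ O

omit [CharZero K] in
theorem IsUnitIn.zpow_mem {O : Subring K} {y : K} (hy : IsUnitIn O y) (e : ℤ) : y ^ e ∈ O := by
  obtain ⟨n, rfl | rfl⟩ := e.eq_nat_or_neg
  · rw [zpow_natCast]
    exact pow_mem hy.2.1 n
  · rw [zpow_neg, zpow_natCast, ← inv_pow]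
    exact pow_mem hy.2.2 n

/-- Every primitive integral combination of the family `X` is a unit of `O`. -/
def Unimodular (O : Subring K) (ℓ : ℕ) (X : ι → K) : Prop :=
  ∀ c : ι → ℤ, (∃ i, ¬ (ℓ : ℤ) ∣ c i) → IsUnitIn O (∑ i, (c i : K) * X i)

/-- `c` clears the denominators of the coefficients of total degree `N` of the products
of series `z * cothFun (exp z)` and `z / 2`. -/
def ClearsCoth (O : Subring K) (ι : Type*) [Fintype ι] (N : ℕ) (c : K) : Prop :=
  ∀ m : ι → ℕ, ∑ i, m i = N → ∀ t : ι → K,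
    (∀ i, t i = cothCoeff (m i) ∨ t i = if m i = 1 then 1 / 2 else 0) → c * ∏ i, t i ∈ O

/-- The Laurent series whose `k`-th coefficient is carried into `O` by `c`. -/
def integralAt (O : Subring K) (c : K) (k : ℤ) : AddSubgroup (LaurentSeries K) where
  carrier := {f | c * f.coeff k ∈ O}
  add_mem' {f g} hf hg := by
    simp only [Set.mem_ofPred_eq, HahnSeries.coeff_add, mul_add] at *
    exact add_mem hf hg
  zero_mem' := by simp
  neg_mem' {f} hf := by
    simp only [Set.mem_ofPred_eq, HahnSeries.coeff_neg, mul_neg] at *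
    exact neg_mem hf

omit [CharZero K] in
theorem mem_integralAt {O : Subring K} {c : K} {k : ℤ} {f : LaurentSeries K} :
    f ∈ integralAt O c k ↔ c * f.coeff k ∈ O := Iff.rfl

omit [CharZero K] in
theorem C_mul_mem_integralAt {O : Subring K} {c : K} {k : ℤ} {f : LaurentSeries K} {a : K}
    (ha : a ∈ O) (hf : f ∈ integralAt O c k) : HahnSeries.C a * f ∈ integralAt O c k := by
  rw [mem_integralAt, HahnSeries.C_mul_eq_smul, HahnSeries.coeff_smul, smul_eq_mul,
    mul_left_comm]
  exact mul_mem ha hf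

/-- Each coefficient of `z * g i` is a coefficient cleared by `c` times a power of a unit of `O`.
Negative powers occur, so membership of `y` in `O` would not suffice. -/
theorem prod_mem_integralAt [DecidableEq ι] {O : Subring K} {N : ℕ} {c : K}
    (hc : ClearsCoth O ι N c) (g : ι → LaurentSeries K)
    (hg : ∀ i, g i = 1 / 2 ∨ ∃ y, IsUnitIn O y ∧ g i = cothFun (expLaurent y)) :
    ∏ i, g i ∈ integralAt O c ((N : ℤ) - Fintype.card ι) := by
  have h : ∀ i, ∃ F : PowerSeries K,
      HahnSeries.single (1 : ℤ) (1 : K) * g i = HahnSeries.ofPowerSeries ℤ K F ∧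
      ∀ m : ℕ, ∃ t v : K, F.coeff m = t * v ∧ v ∈ O ∧
        (t = cothCoeff m ∨ t = if m = 1 then 1 / 2 else 0) := by
    intro i
    rcases hg i with h | ⟨y, hy, h⟩
    · refine ⟨PowerSeries.C (1 / 2) * PowerSeries.X, ?_, fun m => ⟨if m = 1 then 1 / 2 else 0, 1,
        ?_, one_mem _, Or.inr rfl⟩⟩
      · have h12 : (HahnSeries.C (1 / 2 : K) : LaurentSeries K) = 1 / 2 := by
          rw [map_div₀, map_one, map_ofNat]
        rw [h, map_mul, HahnSeries.ofPowerSeries_C, HahnSeries.ofPowerSeries_X, h12, mul_comm]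
      · rw [PowerSeries.coeff_C_mul, PowerSeries.coeff_X]
        simp
    · refine ⟨_, by rw [h]; exact single_mul_cothFun_expLaurent hy.1, fun m =>
        ⟨_, _, PowerSeries.coeff_mk _ _, hy.zpow_mem _, Or.inl rfl⟩⟩
  choose F hF t v htv hv ht using h
  rw [mem_integralAt, coeff_prod_of_single_mul g F hF, Finset.mul_sum]
  refine sum_mem fun m hm => ?_
  rw [Finset.prod_congr rfl fun i _ => htv i (m i), Finset.prod_mul_distrib, ← mul_assoc]
  refine mul_mem (hc m (by simpa using hm) _ fun i => ht i (m i)) (prod_mem fun i _ => hv i _)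

omit [CharZero K] in
theorem Unimodular.isUnitIn [DecidableEq ι] {O : Subring K} {ℓ : ℕ} (hℓ : ℓ.Prime) {X : ι → K}
    (hX : Unimodular O ℓ X) (i : ι) : IsUnitIn O (X i) := by
  have := hX (Pi.single i 1) ⟨i, by
    rw [Pi.single_eq_same]
    exact fun h => hℓ.one_lt.ne' (by exact_mod_cast Int.eq_one_of_dvd_one (by positivity) h)⟩
  simpa [Pi.single_apply] using this

/-- Up to the unit `P i`, the change of forms is an integral matrix invertible modulo `ℓ`. A
combination `c` of the new forms is `(P i)⁻¹` times the combination `b` of the old ones; if `ℓ`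
divides every `c j` with `j ≠ i`, then `b i` is `-Q * c i` modulo `ℓ`. -/
theorem Unimodular.reciprocalForms [DecidableEq ι] {O : Subring K} {ℓ : ℕ} (hℓ : ℓ.Prime)
    (hO : ∀ m : ℤ, ¬ (ℓ : ℤ) ∣ m → (m : K)⁻¹ ∈ O) {X : ι → K} (hX : Unimodular O ℓ X) {Q : ℕ}
    (hQ : ¬ ℓ ∣ Q) {P : ι → ℕ} {i : ι} (hi : ¬ ℓ ∣ P i) :
    Unimodular O ℓ (reciprocalForms Q P X i) := by
  have hℓ' : Prime (ℓ : ℤ) := Nat.prime_iff_prime_int.1 hℓ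
  have hP0 : (P i : K) ≠ 0 := by
    intro h
    rw [Nat.cast_eq_zero] at h
    exact hi (h ▸ dvd_zero _)
  intro c hc
  set b : ι → ℤ := Function.update (fun j => P i * c j) i
    (-(Q * c i + ∑ j ∈ Finset.univ.erase i, c j * P j)) with hb
  have hbu : IsUnitIn O (∑ j, (b j : K) * X j) := by
    apply hX
    by_cases h : ∃ j, j ≠ i ∧ ¬ (ℓ : ℤ) ∣ c j
    · obtain ⟨j, hj, hcj⟩ := h
      refine ⟨j, ?_⟩
      rw [hb, Function.update_of_ne hj]
      intro h
      rcases hℓ'.dvd_or_dvd h with h | h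
      · exact hi (Int.natCast_dvd_natCast.1 h)
      · exact hcj h
    · push Not at h
      have hci : ¬ (ℓ : ℤ) ∣ c i := by
        obtain ⟨k, hk⟩ := hc
        by_cases hki : k = i
        · exact hki ▸ hk
        · exact absurd (h k hki) hk
      refine ⟨i, ?_⟩
      rw [hb, Function.update_self, dvd_neg]
      intro hd
      have h1 : (ℓ : ℤ) ∣ ∑ j ∈ Finset.univ.erase i, c j * P j :=
        Finset.dvd_sum fun j hj => Dvd.dvd.mul_right (h j (Finset.ne_of_mem_erase hj)) _
      rcases hℓ'.dvd_or_dvd ((dvd_add_left h1).1 hd) with h | h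
      · exact hQ (Int.natCast_dvd_natCast.1 h)
      · exact hci h
  have heq : ∑ j, (c j : K) * _root_.reciprocalForms Q P X i j =
      (P i : K)⁻¹ * ∑ j, (b j : K) * X j := by
    rw [← Finset.add_sum_erase _ _ (Finset.mem_univ i),
      ← Finset.add_sum_erase _ (fun j => (b j : K) * X j) (Finset.mem_univ i)]
    have h1 : ∀ j ∈ Finset.univ.erase i, (c j : K) * _root_.reciprocalForms Q P X i j =
        c j * X j - (c j * P j) * (X i / P i) := by
      intro j hj
      rw [_root_.reciprocalForms, Function.update_of_ne (Finset.ne_of_mem_erase hj)]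
      ring
    have h2 : ∀ j ∈ Finset.univ.erase i, (b j : K) * X j = P i * (c j * X j) := by
      intro j hj
      rw [hb, Function.update_of_ne (Finset.ne_of_mem_erase hj)]
      push_cast
      ring
    rw [Finset.sum_congr rfl h1, Finset.sum_congr rfl h2, Finset.sum_sub_distrib,
      ← Finset.sum_mul, ← Finset.mul_sum, hb, Function.update_self, _root_.reciprocalForms,
      Function.update_self]
    push_cast
    field_simp
    ring
  rw [heq]
  have hPi : (P i : K)⁻¹ ∈ O := by
    have := hO (P i) fun h => hi (Int.natCast_dvd_natCast.1 h)
    exact_mod_cast this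
  refine ⟨mul_ne_zero (inv_ne_zero hP0) hbu.1, mul_mem hPi hbu.2.1, ?_⟩
  rw [mul_inv, inv_inv]
  exact mul_mem (natCast_mem _ _) hbu.2.2

/-- Reduce `p` modulo `Q`. If the remainder is nonzero and divisible by `ℓ`, its complement in `Q`
is prime to `ℓ`, and oddness of the cotangent moves the sign to `x`. -/
theorem exists_normalized_weight {ℓ Q : ℕ} (hQ0 : 0 < Q) (hQ : ¬ ℓ ∣ Q) (p : ℕ) {x : K}
    (hx : x ≠ 0) : ∃ (p' : ℕ) (ε : ℤ), p' < Q ∧ (p' = 0 ∨ ¬ ℓ ∣ p') ∧ (ε = 1 ∨ ε = -1) ∧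
      ∀ w : K, w ^ Q = 1 → cothFun (HahnSeries.C (w ^ p) * expLaurent x) =
        (ε : LaurentSeries K) * cothFun (HahnSeries.C (w ^ p') * expLaurent (ε * x)) := by
  have hmod : ∀ w : K, w ^ Q = 1 → w ^ p = w ^ (p % Q) := fun w hw => by
    conv_lhs => rw [← Nat.div_add_mod p Q, pow_add, pow_mul, hw, one_pow, one_mul]
  have hlt := Nat.mod_lt p hQ0
  by_cases h : p % Q = 0 ∨ ¬ ℓ ∣ p % Q
  · refine ⟨p % Q, 1, hlt, h, Or.inl rfl, fun w hw => ?_⟩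
    rw [hmod w hw]
    simp
  · push Not at h
    refine ⟨Q - p % Q, -1, by omega, Or.inr fun h' => hQ ?_, Or.inr rfl, fun w hw => ?_⟩
    · have := dvd_add h' h.2
      rwa [Nat.sub_add_cancel hlt.le] at this
    · have hw0 : w ≠ 0 := by
        rintro rfl
        rw [zero_pow hQ0.ne'] at hw
        exact zero_ne_one hw
      have h1 : w ^ p = (w ^ (Q - p % Q))⁻¹ := by
        rw [hmod w hw]
        refine eq_inv_of_mul_eq_one_left ?_
        rw [← pow_add, Nat.add_sub_cancel' hlt.le, hw]
      have h2 : HahnSeries.C (w ^ p) * expLaurent x =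
          (HahnSeries.C (w ^ (Q - p % Q)) * expLaurent (-x))⁻¹ := by
        rw [h1, expLaurent_neg, mul_inv, inv_inv, map_inv₀]
      rw [h2, cothFun_inv]
      · simp
      · exact mul_ne_zero ((map_ne_zero_iff _ HahnSeries.C_injective).2 (pow_ne_zero _ hw0))
          (expLaurent_ne_zero _)
      · exact C_mul_expLaurent_ne_one (pow_ne_zero _ hw0) (neg_ne_zero.2 hx)

/-- The two products differ by the sign `(-1) ^ k`, where `k` counts the nonzero weights. Hence the
outer factor `1 / 2` costs no denominator. -/
theorem reciprocity_boundary_eq {J : Type*} [Fintype J] (P : J → ℕ) (f : J → LaurentSeries K) :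
    (1 / 2 * ((∏ i, if P i = 0 then f i else 1 / 2) + ∏ i, if P i = 0 then f i else -(1 / 2)) =
      ∏ i, if P i = 0 then f i else 1 / 2) ∨
    1 / 2 * ((∏ i, if P i = 0 then f i else 1 / 2) + ∏ i, if P i = 0 then f i else -(1 / 2)) =
      0 := by
  have h : (∏ i, if P i = 0 then f i else -(1 / 2)) =
      (-1) ^ (Finset.univ.filter fun i => ¬ P i = 0).card *
        ∏ i, if P i = 0 then f i else 1 / 2 := by
    rw [Finset.card_filter, ← Finset.prod_pow_eq_pow_sum, ← Finset.prod_mul_distrib]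
    refine Finset.prod_congr rfl fun i _ => ?_
    by_cases h : P i = 0 <;> simp [h]
  rw [h]
  rcases neg_one_pow_eq_or (LaurentSeries K) (Finset.univ.filter fun i => ¬ P i = 0).card
    with h | h
  · left
    rw [h]
    ring
  · right
    rw [h]
    ring

theorem boundary_mem_integralAt [DecidableEq ι] {O : Subring K} {N : ℕ} {c : K}
    (hc : ClearsCoth O ι N c) (P : ι → ℕ) {X : ι → K} (hX : ∀ i, IsUnitIn O (X i)) :
    1 / 2 * ((∏ i, if P i = 0 then cothFun (expLaurent (X i)) else 1 / 2) +
        ∏ i, if P i = 0 then cothFun (expLaurent (X i)) else -(1 / 2)) ∈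
      integralAt O c ((N : ℤ) - Fintype.card ι) := by
  rcases reciprocity_boundary_eq P fun i => cothFun (expLaurent (X i)) with h | h
  · rw [h]
    refine prod_mem_integralAt hc _ fun i => ?_
    split_ifs
    · exact Or.inr ⟨X i, hX i, rfl⟩
    · exact Or.inl rfl
  · rw [h]
    exact zero_mem _

theorem cothSum_eq [IsAlgClosed K] [DecidableEq ι] {Q : ℕ} (hQ : 0 < Q) (P : ι → ℕ) (X : ι → K)
    (hX : ∀ i, X i ≠ 0) (hXX : ∀ i j, i ≠ j → P i ≠ 0 → X j - P j * X i / P i ≠ 0) :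
    cothSum Q P X = HahnSeries.C (Q : K) *
      (1 / 2 * ((∏ i, if P i = 0 then cothFun (expLaurent (X i)) else 1 / 2) +
        ∏ i, if P i = 0 then cothFun (expLaurent (X i)) else -(1 / 2)) -
      ∑ i, HahnSeries.C (P i : K)⁻¹ *
        cothSum (P i) (Function.update P i Q) (reciprocalForms Q P X i)) := by
  have hQL : (Q : LaurentSeries K) ≠ 0 := by exact_mod_cast hQ.ne'
  simp only [map_inv₀, map_natCast]
  rw [← cothSum_reciprocity hQ P X hX hXX]
  field_simp
  ring

/-- Integrality of the coefficients of `cothSum` at primes that do not divide the modulus. -/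
theorem cothSum_mem_integralAt [IsAlgClosed K] [DecidableEq ι] {O : Subring K} {ℓ : ℕ}
    (hℓ : ℓ.Prime) (hO : ∀ m : ℤ, ¬ (ℓ : ℤ) ∣ m → (m : K)⁻¹ ∈ O) {N : ℕ} {c : K}
    (hc : ClearsCoth O ι N c) (Q : ℕ) (hQ : ¬ ℓ ∣ Q) (P : ι → ℕ) (X : ι → K)
    (hX : Unimodular O ℓ X) : cothSum Q P X ∈ integralAt O c ((N : ℤ) - Fintype.card ι) := by
  induction Q using Nat.strong_induction_on generalizing P X with
  | _ Q ih =>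
  have hQ0 : 0 < Q := Nat.pos_of_ne_zero fun h => hQ (h ▸ dvd_zero _)
  choose P' ε hlt hP' hε hcoth using fun i =>
    exists_normalized_weight hQ0 hQ (P i) (hX.isUnitIn hℓ i).1
  set X' : ι → K := fun i => ε i * X i with hX'
  have hεd : ∀ i, (ε i) * ε i = 1 := fun i => by rcases hε i with h | h <;> rw [h] <;> norm_num
  have hXu : Unimodular O ℓ X' := by
    intro a ⟨i, hi⟩
    have := hX (fun i => a i * ε i) ⟨i, fun h => hi (by
      have := Dvd.dvd.mul_right h (ε i)
      rwa [mul_assoc, hεd, mul_one] at this)⟩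
    convert this using 2
    push_cast
    rw [hX']
    ring
  have hsum : cothSum Q P X = HahnSeries.C (∏ i, (ε i : K)) * cothSum Q P' X' := by
    rw [cothSum, cothSum, Finset.mul_sum]
    refine Finset.sum_congr rfl fun w hw => ?_
    rw [Polynomial.mem_nthRootsFinset hQ0] at hw
    rw [Finset.prod_congr rfl fun i _ => hcoth i w hw, Finset.prod_mul_distrib, map_prod]
    simp only [map_intCast, hX']
  rw [hsum]
  refine C_mul_mem_integralAt (prod_mem fun i _ => intCast_mem _ _) ?_
  have hrec : ∀ i, P' i ≠ 0 → Unimodular O ℓ (reciprocalForms Q P' X' i) := fun i hi =>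
    hXu.reciprocalForms hℓ hO hQ ((hP' i).resolve_left hi)
  have key := cothSum_eq hQ0 P' X' (fun i => (hXu.isUnitIn hℓ i).1)
    (by
      intro i j hij hi
      have := ((hrec i hi).isUnitIn hℓ j).1
      rwa [reciprocalForms, Function.update_of_ne hij.symm] at this)
  rw [key]
  refine C_mul_mem_integralAt (natCast_mem _ _) (sub_mem
    (boundary_mem_integralAt hc _ fun i => hXu.isUnitIn hℓ i) (sum_mem fun i _ => ?_))
  -- A zero weight contributes no poles. Otherwise `P' i` is a smaller modulus prime to `ℓ`, and the
  -- descent continues.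
  by_cases hi : P' i = 0
  · rw [hi]
    simp [zero_mem]
  · have hi' := (hP' i).resolve_left hi
    refine C_mul_mem_integralAt ?_ (ih (P' i) (hlt i) hi' _ _ (hrec i hi))
    have := hO (P' i) fun h => hi' (Int.natCast_dvd_natCast.1 h)
    exact_mod_cast this

end

/-! ### Localization at a prime and Gauss's lemma -/

/-- The localization of `R` at the prime ideal generated by `π`, as a subring of a field. -/
def localizationAtPrime {R K : Type*} [CommRing R] [Field K] (f : R →+* K) {π : R}
    (hπ : Prime π) : Subring K where
  carrier := {y | ∃ a b : R, ¬ π ∣ b ∧ y * f b = f a}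
  zero_mem' := ⟨0, 1, fun h => hπ.not_isUnit (isUnit_of_dvd_one h), by simp⟩
  one_mem' := ⟨1, 1, fun h => hπ.not_isUnit (isUnit_of_dvd_one h), by simp⟩
  add_mem' := by
    rintro y z ⟨a, b, hb, h⟩ ⟨a', b', hb', h'⟩
    refine ⟨a * b' + a' * b, b * b', fun hd => (hπ.dvd_or_dvd hd).elim hb hb', ?_⟩
    simp only [map_mul, map_add]
    linear_combination f b' * h + f b * h'
  mul_mem' := by
    rintro y z ⟨a, b, hb, h⟩ ⟨a', b', hb', h'⟩
    refine ⟨a * a', b * b', fun hd => (hπ.dvd_or_dvd hd).elim hb hb', ?_⟩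
    simp only [map_mul]
    linear_combination z * f b' * h + f a * h'
  neg_mem' := by
    rintro y ⟨a, b, hb, h⟩
    refine ⟨-a, b, hb, ?_⟩
    rw [map_neg]
    linear_combination -h

theorem mem_localizationAtPrime {R K : Type*} [CommRing R] [Field K] {f : R →+* K} {π : R}
    {hπ : Prime π} {y : K} :
    y ∈ localizationAtPrime f hπ ↔ ∃ a b : R, ¬ π ∣ b ∧ y * f b = f a := Iff.rfl

section
variable {R K : Type*} [CommRing R] [Field K] {f : R →+* K} {π : R} {hπ : Prime π}

theorem map_mem_localizationAtPrime (a : R) : f a ∈ localizationAtPrime f hπ :=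
  ⟨a, 1, fun h => hπ.not_isUnit (isUnit_of_dvd_one h), by simp⟩

theorem inv_map_mem_localizationAtPrime (hf : Function.Injective f) {b : R} (hb : ¬ π ∣ b) :
    (f b)⁻¹ ∈ localizationAtPrime f hπ := by
  refine ⟨1, b, hb, ?_⟩
  rw [map_one, inv_mul_cancel₀]
  rw [map_ne_zero_iff f hf]
  rintro rfl
  exact hb (dvd_zero _)

theorem map_isUnitIn_localizationAtPrime (hf : Function.Injective f) {b : R} (hb : ¬ π ∣ b) :
    IsUnitIn (localizationAtPrime f hπ) (f b) := by
  refine ⟨?_, map_mem_localizationAtPrime b, inv_map_mem_localizationAtPrime hf hb⟩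
  rw [map_ne_zero_iff f hf]
  rintro rfl
  exact hb (dvd_zero _)

end

/-- The rational numbers that are integral at `ℓ`. -/
def rationalsAt {ℓ : ℕ} (hℓ : ℓ.Prime) : Subring ℚ :=
  localizationAtPrime (Int.castRingHom ℚ) (Nat.prime_iff_prime_int.1 hℓ)

theorem mem_rationalsAt {ℓ : ℕ} {hℓ : ℓ.Prime} {y : ℚ} :
    y ∈ rationalsAt hℓ ↔ ∃ a b : ℤ, ¬ (ℓ : ℤ) ∣ b ∧ y * b = a := Iff.rfl

theorem inv_mem_rationalsAt {ℓ : ℕ} {hℓ : ℓ.Prime} {b : ℤ} (hb : ¬ (ℓ : ℤ) ∣ b) :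
    (b : ℚ)⁻¹ ∈ rationalsAt hℓ :=
  inv_map_mem_localizationAtPrime (f := Int.castRingHom ℚ) Int.cast_injective hb

theorem exists_int_eq_of_mem_rationalsAt (y : ℚ) (h : ∀ (ℓ : ℕ) (hℓ : ℓ.Prime), y ∈ rationalsAt hℓ) :
    ∃ a : ℤ, (a : ℚ) = y := by
  have hden : y.den = 1 := by
    by_contra hne
    obtain ⟨ℓ, hℓ, hd⟩ := Nat.exists_prime_and_dvd hne
    obtain ⟨a, b, hb, hab⟩ := mem_rationalsAt.1 (h ℓ hℓ)
    have h1 : y.num * b = a * y.den := by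
      have h2 : (y.den : ℚ) ≠ 0 := by exact_mod_cast y.den_ne_zero
      have h3 : y * y.den = y.num := Rat.mul_den_eq_num y
      have : (y.num : ℚ) * b = a * y.den := by rw [← h3, ← hab]; ring
      exact_mod_cast this
    have h2 : (ℓ : ℤ) ∣ y.num * b := by
      rw [h1]
      exact Dvd.dvd.mul_left (Int.natCast_dvd_natCast.2 hd) _
    rcases (Nat.prime_iff_prime_int.1 hℓ).dvd_or_dvd h2 with h2 | h2
    · have h3 : ℓ ∣ y.num.natAbs := Int.natCast_dvd.1 h2
      exact hℓ.one_lt.ne' (Nat.dvd_one.1 (y.reduced ▸ Nat.dvd_gcd h3 hd))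
    · exact hb h2
  exact ⟨y.num, Rat.coe_int_num_of_den_eq_one hden⟩

section
open MvPolynomial
variable {K : Type*} [Field K] [CharZero K] {ι : Type*} [Fintype ι]

theorem prime_C_natCast (ι : Type*) {ℓ : ℕ} (hℓ : ℓ.Prime) :
    Prime (C (ℓ : ℤ) : MvPolynomial ι ℤ) :=
  (prime_C_iff ι).2 (Nat.prime_iff_prime_int.1 hℓ)

/-- The localization of `ℤ[x]` at the prime `ℓ`, for a family `x` in a field. -/
noncomputable def gaussSubring {ℓ : ℕ} (hℓ : ℓ.Prime) (x : ι → K) : Subring K :=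
  localizationAtPrime (aeval x : MvPolynomial ι ℤ →ₐ[ℤ] K).toRingHom (prime_C_natCast ι hℓ)

variable {ℓ : ℕ} {hℓ : ℓ.Prime} {x : ι → K}

omit [Fintype ι] in
theorem injective_aeval_int (hx : AlgebraicIndependent ℚ x) :
    Function.Injective (aeval x : MvPolynomial ι ℤ →ₐ[ℤ] K).toRingHom :=
  hx.restrictScalars (R := ℤ) Int.cast_injective

omit [Fintype ι] in
theorem inv_intCast_mem_gaussSubring (hx : AlgebraicIndependent ℚ x) (m : ℤ)
    (hm : ¬ (ℓ : ℤ) ∣ m) : (m : K)⁻¹ ∈ gaussSubring hℓ x := by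
  have := inv_map_mem_localizationAtPrime (hπ := prime_C_natCast ι hℓ) (injective_aeval_int hx)
    (b := C m) (by
      rw [C_dvd_iff_dvd_coeff]
      intro h
      have := h 0
      rw [coeff_zero_C] at this
      exact hm this)
  simpa [gaussSubring] using this

omit [Fintype ι] in
theorem ratCast_mem_gaussSubring (hx : AlgebraicIndependent ℚ x) {y : ℚ}
    (hy : y ∈ rationalsAt hℓ) : (y : K) ∈ gaussSubring hℓ x := by
  obtain ⟨a, b, hb, h⟩ := mem_rationalsAt.1 hy
  have hb0 : (b : K) ≠ 0 := by
    intro h0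
    rw [Int.cast_eq_zero] at h0
    exact hb (h0 ▸ dvd_zero _)
  have h1 : (y : K) = a * (b : K)⁻¹ := by
    rw [eq_mul_inv_iff_mul_eq₀ hb0]
    exact_mod_cast congrArg (Rat.cast : ℚ → K) h
  rw [h1]
  exact mul_mem (intCast_mem _ _) (inv_intCast_mem_gaussSubring hx b hb)

/-- An integral polynomial becomes a unit as soon as `ℓ` fails to divide one of its coefficients;
here this applies to linear forms. -/
theorem unimodular_gaussSubring (hx : AlgebraicIndependent ℚ x) :
    Unimodular (gaussSubring hℓ x) ℓ x := by
  classical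
  rintro c ⟨i, hi⟩
  have := map_isUnitIn_localizationAtPrime (hπ := prime_C_natCast ι hℓ) (injective_aeval_int hx)
    (b := ∑ j, C (c j) * X j) (by
      rw [C_dvd_iff_dvd_coeff]
      intro h
      have := h (Finsupp.single i 1)
      simp only [coeff_sum, coeff_C_mul, coeff_X, Finsupp.single_left_inj one_ne_zero] at this
      simp at this
      exact hi this)
  simpa [gaussSubring] using this

omit [Fintype ι] in
theorem exists_nat_mul_eq_map (g : MvPolynomial ι ℚ) :
    ∃ (M : ℕ) (G : MvPolynomial ι ℤ), M ≠ 0 ∧ C (M : ℚ) * g = map (Int.castRingHom ℚ) G := by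
  induction g using MvPolynomial.induction_on' with
  | monomial m a =>
    refine ⟨a.den, monomial m a.num, a.den_ne_zero, ?_⟩
    rw [C_mul_monomial, map_monomial]
    congr 1
    rw [mul_comm]
    exact Rat.mul_den_eq_num a
  | add p q hp hq =>
    obtain ⟨M, G, hM, h⟩ := hp
    obtain ⟨M', G', hM', h'⟩ := hq
    refine ⟨M * M', C (M' : ℤ) * G + C (M : ℤ) * G', mul_ne_zero hM hM', ?_⟩
    simp only [map_add, map_mul, ← h, ← h', map_C, Nat.cast_mul]
    simp only [Int.coe_castRingHom, Int.cast_natCast]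
    ring

omit [Fintype ι] in
/-- Gauss's lemma. -/
theorem coeff_mem_of_aeval_mem_gaussSubring (hx : AlgebraicIndependent ℚ x)
    {g : MvPolynomial ι ℚ} (hg : aeval x g ∈ gaussSubring hℓ x) (m : ι →₀ ℕ) :
    g.coeff m ∈ rationalsAt hℓ := by
  obtain ⟨a, b, hb, h⟩ := mem_localizationAtPrime.1 hg
  obtain ⟨M, G, hM, hG⟩ := exists_nat_mul_eq_map g
  obtain ⟨k, M', hM', rfl⟩ := Nat.exists_eq_pow_mul_and_not_dvd hM ℓ hℓ.one_lt.ne'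
  have hmap : ∀ p : MvPolynomial ι ℤ, (aeval x : MvPolynomial ι ℤ →ₐ[ℤ] K).toRingHom p =
      aeval x (map (Int.castRingHom ℚ) p) := by
    intro p
    have := aeval_map_algebraMap (R := ℤ) ℚ x p
    simpa using this.symm
  have h1 : G * b = C (ℓ : ℤ) ^ k * (C (M' : ℤ) * a) := by
    apply injective_aeval_int hx
    rw [map_mul, map_mul, map_mul, ← h, hmap G, ← hG, map_mul]
    simp
    ring
  -- Since `ℓ` remains prime in `ℤ[x]` and does not divide `b`, the whole power `ℓ ^ k` of the
  -- common denominator divides `G`.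
  have h2 : (C (ℓ : ℤ) : MvPolynomial ι ℤ) ^ k ∣ G :=
    (prime_C_natCast ι hℓ).pow_dvd_of_dvd_mul_right k hb ⟨_, h1⟩
  obtain ⟨G', rfl⟩ := h2
  have h3 := congrArg (coeff m) hG
  rw [coeff_C_mul, coeff_map, ← map_pow, coeff_C_mul] at h3
  refine ⟨G'.coeff m, M', fun hd => hM' (Int.natCast_dvd_natCast.1 hd), ?_⟩
  have hℓ0 : (ℓ : ℚ) ^ k ≠ 0 := pow_ne_zero _ (by exact_mod_cast hℓ.ne_zero)
  refine mul_left_cancel₀ hℓ0 ?_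
  push_cast at h3 ⊢
  simp only [eq_intCast, Int.cast_mul, Int.cast_pow, Int.cast_natCast] at h3
  linear_combination h3

end

/-! ### Binomial expansions and partial fractions -/

section
variable {K : Type*} [Field K] [CharZero K]

/-- The coefficient of `s ^ r * x ^ (r - 1)` in `s * (a + x * s) ^ (m - 1)`. -/
noncomputable def shiftedBinomial (a : ℚ) (m r : ℕ) : ℚ :=
  if r = 0 then 0 else (Ring.choose ((m : ℤ) - 1) (r - 1) : ℤ) * a ^ ((m : ℤ) - r)

/-- Pascal's rule, corresponding to multiplication by `a + x * s`. -/
theorem shiftedBinomial_succ_succ {a : ℚ} (ha : a ≠ 0) (m r : ℕ) :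
    shiftedBinomial a (m + 1) (r + 1) =
      shiftedBinomial a m (r + 1) * a + shiftedBinomial a m r := by
  rcases r with _ | r
  · simp [shiftedBinomial, zpow_sub_one₀ ha, ha]
  · have h : Ring.choose (((m + 1 : ℕ) : ℤ) - 1) (r + 1) =
        Ring.choose ((m : ℤ) - 1) r + Ring.choose ((m : ℤ) - 1) (r + 1) := by
      rw [← Ring.choose_succ_succ]
      congr 1
      push_cast
      ring
    have e1 : (((m + 1 : ℕ) : ℤ) - ((r + 1 + 1 : ℕ) : ℤ)) = (m : ℤ) - (r + 1 : ℕ) := by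
      push_cast; ring
    have e2 : ((m : ℤ) - ((r + 1 + 1 : ℕ) : ℤ)) = (m : ℤ) - (r + 1 : ℕ) - 1 := by
      push_cast; ring
    simp only [shiftedBinomial, Nat.succ_ne_zero, if_false, Nat.add_sub_cancel, h, e1, e2,
      zpow_sub_one₀ ha]
    push_cast
    field_simp
    ring

/-- For `m = 0` the series is `s / (a + x * s)`, with binomials `(-1) ^ k`; multiplying by `a + x *
s` must return `s`. -/
theorem shiftedBinomial_zero_succ {a : ℚ} (ha : a ≠ 0) (r : ℕ) :
    shiftedBinomial a 0 (r + 1) * a + shiftedBinomial a 0 r = if r = 0 then 1 else 0 := by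
  have hc : ∀ k : ℕ, Ring.choose (((0 : ℕ) : ℤ) - 1) k = (-1) ^ k := fun k => by
    have h := Ring.choose_neg (1 : ℤ) k
    rw [show (1 : ℤ) + k - 1 = (k : ℕ) by ring, Ring.choose_natCast,
      Nat.choose_self] at h
    rw [show ((0 : ℕ) : ℤ) - 1 = -1 by norm_num, h]
    simp [Int.negOnePow_def, Units.smul_def]
  rcases r with _ | r
  · simp [shiftedBinomial, ha]
  · have e : (((0 : ℕ) : ℤ) - ((r + 1 + 1 : ℕ) : ℤ)) = ((0 : ℕ) : ℤ) - (r + 1 : ℕ) - 1 := by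
      push_cast; ring
    simp only [shiftedBinomial, Nat.succ_ne_zero, if_false, Nat.add_sub_cancel, hc, e,
      zpow_sub_one₀ ha]
    push_cast
    field_simp
    ring

omit [CharZero K] in
theorem C_add_single_ne_zero {a : K} (ha : a ≠ 0) (x : K) :
    (HahnSeries.C a + HahnSeries.single 1 x : LaurentSeries K) ≠ 0 := by
  intro h
  have := congrArg (fun f => HahnSeries.coeff f 0) h
  simp [HahnSeries.C_apply, HahnSeries.coeff_single_same, HahnSeries.coeff_single_of_ne] at this
  exact ha this

theorem single_mul_zpow {a : ℚ} (ha : a ≠ 0) {x : K} (hx : x ≠ 0) (m : ℕ) :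
    HahnSeries.single (1 : ℤ) (1 : K) *
        (HahnSeries.C (a : K) + HahnSeries.single 1 x) ^ ((m : ℤ) - 1) =
      HahnSeries.ofPowerSeries ℤ K
        (PowerSeries.mk fun r => (shiftedBinomial a m r : K) * x ^ ((r : ℤ) - 1)) := by
  have haK : (a : K) ≠ 0 := by exact_mod_cast ha
  have hne := C_add_single_ne_zero haK x
  have hof : (HahnSeries.C (a : K) + HahnSeries.single 1 x : LaurentSeries K) =
      HahnSeries.ofPowerSeries ℤ K (PowerSeries.C (a : K) + PowerSeries.C x * PowerSeries.X) := by
    rw [map_add, map_mul, HahnSeries.ofPowerSeries_C, HahnSeries.ofPowerSeries_C,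
      HahnSeries.ofPowerSeries_X, HahnSeries.C_apply x, HahnSeries.single_mul_single, zero_add,
      mul_one]
  have hcoeff : ∀ (F : PowerSeries K) (r : ℕ),
      PowerSeries.coeff (r + 1) (F * (PowerSeries.C (a : K) + PowerSeries.C x * PowerSeries.X)) =
        PowerSeries.coeff (r + 1) F * a + PowerSeries.coeff r F * x := fun F r => by
    rw [mul_add, map_add, PowerSeries.coeff_mul_C, ← mul_assoc, PowerSeries.coeff_succ_mul_X,
      PowerSeries.coeff_mul_C]
  have hzpow : ∀ r : ℕ, x ^ ((r : ℤ) - 1) * x = x ^ r := fun r => by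
    rw [zpow_sub_one₀ hx, zpow_natCast, inv_mul_cancel_right₀ hx]
  induction m with
  | zero =>
    refine mul_right_cancel₀ hne ?_
    rw [mul_assoc, ← zpow_add_one₀ hne]
    simp only [Nat.cast_zero, zero_sub, neg_add_cancel, zpow_zero, mul_one]
    rw [hof, ← map_mul, ← HahnSeries.ofPowerSeries_X]
    congr 1
    ext r
    rcases r with _ | r
    · simp [shiftedBinomial]
    · rw [hcoeff, PowerSeries.coeff_mk, PowerSeries.coeff_mk, mul_assoc _ _ x, hzpow]
      have h := congrArg (Rat.cast : ℚ → K) (shiftedBinomial_zero_succ ha r)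
      rw [PowerSeries.coeff_X]
      push_cast at h ⊢
      rw [add_sub_cancel_right, zpow_natCast]
      by_cases h0 : r = 0
      · subst h0
        simp at h ⊢
        exact h.symm
      · simp only [h0, if_false, Rat.cast_zero] at h ⊢
        linear_combination -x ^ r * h
  | succ m ih =>
    rw [show ((m + 1 : ℕ) : ℤ) - 1 = (m : ℤ) - 1 + 1 by push_cast; ring, zpow_add_one₀ hne,
      ← mul_assoc, ih, hof, ← map_mul]
    congr 1
    ext r
    rcases r with _ | r
    · simp [shiftedBinomial]
    · rw [hcoeff, PowerSeries.coeff_mk, PowerSeries.coeff_mk, PowerSeries.coeff_mk,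
        mul_assoc _ _ x, hzpow, shiftedBinomial_succ_succ ha]
      push_cast
      rw [add_sub_cancel_right, zpow_natCast]
      ring

theorem single_neg_one_sub_C_ne_zero (a : K) :
    (HahnSeries.single (-1) 1 - HahnSeries.C a : LaurentSeries K) ≠ 0 := by
  intro h
  have := congrArg (fun f => HahnSeries.coeff f (-1)) h
  simp [HahnSeries.C_apply, HahnSeries.coeff_single_same, HahnSeries.coeff_single_of_ne] at this

/-- With `T = s⁻¹`, the expansion at infinity is `1 / (T - a) = s + a * s ^ 2 + ⋯`. Thus the
coefficient of `s` reads off the sum of the finite residues. -/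
theorem coeff_one_inv_single_sub_C (a : K) :
    ((HahnSeries.single (-1) 1 - HahnSeries.C a : LaurentSeries K)⁻¹).coeff 1 = 1 := by
  rcases eq_or_ne a 0 with rfl | ha
  · rw [map_zero, sub_zero, HahnSeries.inv_single]
    simp
  · have h := single_mul_zpow one_ne_zero (neg_ne_zero.2 ha) 0
    have e : (HahnSeries.single (-1) 1 - HahnSeries.C a : LaurentSeries K)⁻¹ =
        HahnSeries.single (1 : ℤ) (1 : K) *
          (HahnSeries.C ((1 : ℚ) : K) + HahnSeries.single 1 (-a)) ^ (((0 : ℕ) : ℤ) - 1) := by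
      rw [Nat.cast_zero, zero_sub, zpow_neg_one]
      refine inv_eq_of_mul_eq_one_left ?_
      have hne := C_add_single_ne_zero (a := ((1 : ℚ) : K)) (by simp) (-a)
      rw [mul_assoc, mul_comm, mul_assoc, inv_mul_eq_iff_eq_mul₀ hne, mul_one, sub_mul,
        HahnSeries.single_mul_single, HahnSeries.C_apply a, HahnSeries.single_mul_single]
      simp [sub_eq_add_neg]
    rw [e, h, show (1 : ℤ) = ((1 : ℕ) : ℤ) by rfl, HahnSeries.ofPowerSeries_apply_coeff,
      PowerSeries.coeff_mk]
    simp [shiftedBinomial]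

open Polynomial in
/-- The sum of the residues of a rational function with simple poles is its residue at infinity. -/
theorem coeff_one_eval_div_prod {J : Type*} [DecidableEq J] (s : Finset J) (v : J → K)
    (hv : Set.InjOn v s) (A : K[X]) :
    (A.eval₂ HahnSeries.C (HahnSeries.single (-1) 1 : LaurentSeries K) *
        ∏ i ∈ s, (HahnSeries.single (-1) 1 - HahnSeries.C (v i))⁻¹).coeff 1 =
      ∑ i ∈ s, A.eval (v i) * ∏ j ∈ s.erase i, (v i - v j)⁻¹ := by
  set T : LaurentSeries K := HahnSeries.single (-1) 1
  have hT : ∀ a, T - HahnSeries.C a ≠ 0 := single_neg_one_sub_C_ne_zero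
  have hmon : (Lagrange.nodal s v).Monic := Lagrange.nodal_monic
  have hR : A %ₘ Lagrange.nodal s v = Lagrange.interpolate s v fun i => A.eval (v i) := by
    refine Lagrange.eq_interpolate_of_eval_eq _ hv ?_ ?_
    · rw [← Lagrange.degree_nodal (s := s) (v := v)]
      exact degree_modByMonic_lt _ hmon
    · intro i hi
      have := congrArg (eval (v i)) (modByMonic_add_div A (Lagrange.nodal s v))
      rw [eval_add, eval_mul, Lagrange.eval_nodal_at_node hi, zero_mul, add_zero] at this
      exact this
  have hnod : (Lagrange.nodal s v).eval₂ HahnSeries.C T = ∏ i ∈ s, (T - HahnSeries.C (v i)) := by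
    rw [Lagrange.nodal_eq, eval₂_finsetProd]
    simp
  have hprod0 : ∏ i ∈ s, (T - HahnSeries.C (v i)) ≠ 0 :=
    Finset.prod_ne_zero_iff.2 fun i _ => hT _
  -- A polynomial in `T = s⁻¹` has only nonpositive powers of `s`, so the quotient of the division
  -- by the nodal polynomial contributes nothing.
  have hq : ∀ q : K[X], (q.eval₂ HahnSeries.C T).coeff 1 = 0 := by
    intro q
    rw [eval₂_eq_sum_range, HahnSeries.coeff_sum]
    refine Finset.sum_eq_zero fun k _ => ?_
    rw [HahnSeries.single_pow, HahnSeries.C_mul_eq_smul, HahnSeries.coeff_smul,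
      HahnSeries.coeff_single_of_ne, smul_zero]
    simp only [smul_neg, nsmul_eq_mul, mul_one, ne_eq]
    omega
  have hbasis : ∀ i ∈ s, (Lagrange.basis s v i).eval₂ HahnSeries.C T *
      ∏ i ∈ s, (T - HahnSeries.C (v i))⁻¹ =
        HahnSeries.C (∏ j ∈ s.erase i, (v i - v j)⁻¹) * (T - HahnSeries.C (v i))⁻¹ := by
    intro i hi
    rw [← Finset.mul_prod_erase s _ hi, Lagrange.basis, eval₂_finsetProd, map_prod,
      mul_left_comm, ← Finset.prod_mul_distrib, mul_comm]
    congr 1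
    refine Finset.prod_congr rfl fun j _ => ?_
    rw [Lagrange.basisDivisor, eval₂_mul, eval₂_C, eval₂_sub, eval₂_X, eval₂_C, mul_assoc,
      mul_inv_cancel₀ (hT _), mul_one]
  have hA : A.eval₂ HahnSeries.C T * ∏ i ∈ s, (T - HahnSeries.C (v i))⁻¹ =
      (∑ i ∈ s, HahnSeries.C (A.eval (v i) * ∏ j ∈ s.erase i, (v i - v j)⁻¹) *
        (T - HahnSeries.C (v i))⁻¹) + (A /ₘ Lagrange.nodal s v).eval₂ HahnSeries.C T := by
    conv_lhs => rw [← modByMonic_add_div A (Lagrange.nodal s v), eval₂_add, eval₂_mul, hnod, hR,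
      Lagrange.interpolate_apply, eval₂_finsetSum, add_mul, Finset.sum_mul]
    congr 1
    · refine Finset.sum_congr rfl fun i hi => ?_
      rw [eval₂_mul, eval₂_C, mul_assoc, hbasis i hi, map_mul, mul_assoc]
    · rw [Finset.prod_inv_distrib, mul_right_comm, mul_inv_cancel₀ hprod0, one_mul]
  rw [hA, HahnSeries.coeff_add, hq, add_zero, HahnSeries.coeff_sum]
  refine Finset.sum_congr rfl fun i _ => ?_
  rw [HahnSeries.C_mul_eq_smul, HahnSeries.coeff_smul, coeff_one_inv_single_sub_C, smul_eq_mul,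
    mul_one]

end

section
variable {K : Type*} [Field K] [CharZero K] {ι : Type*} [Fintype ι] [DecidableEq ι]

theorem Finset.prod_univ_erase_mul_of_filter {M : Type*} [CommMonoid M] {p : ι → Prop}
    [DecidablePred p] {i : ι} (hi : p i) (f : ι → M) :
    ∏ j ∈ univ.erase i, f j =
      (∏ j ∈ (univ.filter p).erase i, f j) * ∏ j ∈ univ.filter fun j => ¬ p j, f j := by
  rw [← prod_filter_mul_prod_filter_not (univ.erase i) p]
  congr 1
  · refine prod_congr ?_ fun _ _ => rfl
    ext j
    simp [and_comm]
  · refine prod_congr ?_ fun _ _ => rfl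
    ext j
    simp only [mem_filter, mem_erase, mem_univ, and_true, true_and, and_iff_right_iff_imp]
    rintro hj rfl
    exact hj hi

-- Residues of `T⁻¹ * ∏ i, (P i * T + x i) ^ (m i - 1)`. The pole at `0` gives `∏ i, x i ^ (m i -
-- 1)`, and the poles `-x i / P i` with `m i = 0` give minus the terms on the left. Expansion at
-- infinity gives the sum of binomial terms, which is a Laurent polynomial although the individual
-- terms on the left are not.
open Polynomial in
theorem partial_fractions (P : ι → ℕ) (hP : ∀ i, P i ≠ 0) (x : ι → K) (hx : ∀ i, x i ≠ 0)
    (hxx : ∀ i j, i ≠ j → x j - P j * x i / P i ≠ 0) (m : ι → ℕ) {N : ℕ} (hm : ∑ i, m i = N) :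
    ∑ i, (if m i = 0 then
        (x i)⁻¹ * ∏ j ∈ Finset.univ.erase i, (x j - P j * x i / P i) ^ ((m j : ℤ) - 1) else 0) =
      ∏ i, x i ^ ((m i : ℤ) - 1) - ∑ r ∈ Finset.piAntidiag Finset.univ N,
        ∏ i, (shiftedBinomial (P i) (m i) (r i) : K) * x i ^ ((r i : ℤ) - 1) := by
  have hPK : ∀ i, (P i : K) ≠ 0 := fun i => by exact_mod_cast hP i
  set T : LaurentSeries K := HahnSeries.single (-1) 1 with hTdef
  have hT0 : T ≠ 0 := by
    have := single_neg_one_sub_C_ne_zero (0 : K)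
    rwa [map_zero, sub_zero] at this
  set Z : Finset ι := Finset.univ.filter fun i => m i = 0 with hZ
  set Y : Finset ι := Finset.univ.filter fun i => ¬ m i = 0 with hY
  let v : Option ι → K := fun o => o.elim 0 fun i => -(x i / P i)
  set A : K[X] := C (∏ i ∈ Z, (P i : K)⁻¹) * ∏ i ∈ Y, (C (P i : K) * X + C (x i)) ^ (m i - 1)
    with hA
  have hv : Function.Injective v := by
    rintro (_ | i) (_ | j) h
    · rfl
    · simp [v, hx, hPK] at h
    · simp [v, hx, hPK] at h
    · by_contra hij
      refine hxx i j (fun h' => hij (congrArg some h')) ?_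
      simp only [v, Option.elim, neg_inj] at h
      have h1 := hPK i
      have h2 := hPK j
      field_simp at h ⊢
      linear_combination -h
  have key := coeff_one_eval_div_prod (Finset.insertNone Z) v hv.injOn A
  have hlin : ∀ i, HahnSeries.C (P i : K) * T + HahnSeries.C (x i) =
      T * (HahnSeries.C ((P i : ℚ) : K) + HahnSeries.single 1 (x i)) := by
    intro i
    rw [mul_add, hTdef, HahnSeries.single_mul_single, HahnSeries.C_apply (x i), mul_comm]
    simp
  have hZfac : ∀ i, (T - HahnSeries.C (v (some i)))⁻¹ * HahnSeries.C (P i : K)⁻¹ =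
      (HahnSeries.C (P i : K) * T + HahnSeries.C (x i))⁻¹ := by
    intro i
    rw [map_inv₀, ← mul_inv]
    congr 1
    have h1 : HahnSeries.C (v (some i)) * HahnSeries.C (P i : K) =
        (-HahnSeries.C (x i) : LaurentSeries K) := by
      rw [← map_mul, ← map_neg]
      congr 1
      have := hPK i
      simp only [v, Option.elim]
      field_simp
    linear_combination -h1
  have hsplit : ∀ {M : Type _} [CommMonoid M] (f : ι → M),
      ∏ i, f i = (∏ i ∈ Z, f i) * ∏ i ∈ Y, f i := fun f =>
    (Finset.prod_filter_mul_prod_filter_not Finset.univ (fun i => m i = 0) f).symm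
  have hzpow : ∀ {F : Type _} [Field F], ∀ i ∈ Y, ∀ a : F, a ^ ((m i : ℤ) - 1) = a ^ (m i - 1) :=
    fun i hi a => by
      have : 1 ≤ m i := Nat.one_le_iff_ne_zero.2 (Finset.mem_filter.1 hi).2
      rw [← Nat.cast_one, ← Nat.cast_sub this, zpow_natCast]
  have hexp : ∀ {F : Type _} [Field F] (f : ι → F), ∏ i, f i ^ ((m i : ℤ) - 1) =
      (∏ i ∈ Z, (f i)⁻¹) * ∏ i ∈ Y, f i ^ (m i - 1) := by
    intro F _ f
    rw [hsplit]
    congr 1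
    · refine Finset.prod_congr rfl fun i hi => ?_
      rw [(Finset.mem_filter.1 hi).2]
      simp
    · exact Finset.prod_congr rfl fun i hi => hzpow i hi _
  -- In `s = T⁻¹`, the function is `s ^ (1 + card ι - N)` times the binomial product, so its
  -- coefficient of `s` is the coefficient of `s ^ (N - card ι)` in that product.
  have hlhs : A.eval₂ HahnSeries.C T *
      ∏ i ∈ Finset.insertNone Z, (T - HahnSeries.C (v i))⁻¹ =
      HahnSeries.single (1 + ((Fintype.card ι : ℤ) - N)) (1 : K) *
        ∏ i, (HahnSeries.C ((P i : ℚ) : K) + HahnSeries.single 1 (x i)) ^ ((m i : ℤ) - 1) := by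
    have h1 : A.eval₂ HahnSeries.C T * ∏ i ∈ Finset.insertNone Z, (T - HahnSeries.C (v i))⁻¹ =
        T⁻¹ * ∏ i, (HahnSeries.C (P i : K) * T + HahnSeries.C (x i)) ^ ((m i : ℤ) - 1) := by
      rw [Finset.prod_insertNone, hexp, ← Finset.prod_congr rfl fun i _ => hZfac i,
        Finset.prod_mul_distrib, hA, eval₂_mul, eval₂_C, eval₂_finsetProd, map_prod]
      simp only [eval₂_pow, eval₂_add, eval₂_mul, eval₂_C, eval₂_X, v, Option.elim, map_zero,
        sub_zero]
      ring
    rw [h1, Finset.prod_congr rfl fun i _ => by rw [hlin i, mul_zpow], Finset.prod_mul_distrib,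
      ← mul_assoc]
    congr 1
    rw [Finset.prod_congr rfl fun i _ => zpow_sub_one₀ hT0 (m i : ℤ), Finset.prod_mul_distrib,
      Finset.prod_const]
    simp only [zpow_natCast]
    rw [Finset.prod_pow_eq_pow_sum, hm, hTdef, HahnSeries.inv_single, HahnSeries.single_pow,
      HahnSeries.single_pow, HahnSeries.single_mul_single, HahnSeries.single_mul_single]
    congr 1
    · simp
      ring_nf
    · simp
  have hcoef : (A.eval₂ HahnSeries.C T *
      ∏ i ∈ Finset.insertNone Z, (T - HahnSeries.C (v i))⁻¹).coeff 1 =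
      ∑ r ∈ Finset.piAntidiag Finset.univ N,
        ∏ i, (shiftedBinomial (P i) (m i) (r i) : K) * x i ^ ((r i : ℤ) - 1) := by
    rw [hlhs, HahnSeries.coeff_single_mul, one_mul,
      show (1 : ℤ) - (1 + ((Fintype.card ι : ℤ) - N)) = (N : ℤ) - Fintype.card ι by ring,
      coeff_prod_of_single_mul _ _ fun i =>
        single_mul_zpow (by exact_mod_cast hP i : (P i : ℚ) ≠ 0) (hx i) (m i)]
    simp only [PowerSeries.coeff_mk]
  rw [hcoef] at key
  rw [key]
  have hsum : ∀ f : Option ι → K,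
      ∑ o ∈ Finset.insertNone Z, f o = f none + ∑ i ∈ Z, f (some i) := fun f => by
    rw [Finset.sum_insertNone]
  have hevA : ∀ a, A.eval a =
      (∏ i ∈ Z, (P i : K)⁻¹) * ∏ i ∈ Y, (P i * a + x i) ^ (m i - 1) := fun a => by
    rw [hA, eval_mul, eval_C, eval_prod]
    simp
  rw [hsum]
  have hnone : (Finset.insertNone Z).erase none = Z.map Function.Embedding.some := by
    ext o
    cases o <;> simp
  have hsome : ∀ i, (Finset.insertNone Z).erase (some i) = Finset.insertNone (Z.erase i) := by
    intro i
    ext o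
    cases o <;> simp
  have h0 : A.eval (v none) * ∏ j ∈ (Finset.insertNone Z).erase none, (v none - v j)⁻¹ =
      ∏ i, x i ^ ((m i : ℤ) - 1) := by
    rw [hnone, Finset.prod_map, hevA, hexp, mul_right_comm, ← Finset.prod_mul_distrib]
    congr 1
    · refine Finset.prod_congr rfl fun i _ => ?_
      have h1 := hPK i
      have h2 := hx i
      simp only [v, Option.elim, Function.Embedding.some_apply]
      rw [zero_sub, neg_neg]
      field_simp
    · simp [v]
  rw [h0]
  have h1 : ∀ i ∈ Z, A.eval (v (some i)) *
      ∏ j ∈ (Finset.insertNone Z).erase (some i), (v (some i) - v j)⁻¹ =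
      -((x i)⁻¹ * ∏ j ∈ Finset.univ.erase i, (x j - P j * x i / P i) ^ ((m j : ℤ) - 1)) := by
    intro i hi
    have hmi : m i = 0 := (Finset.mem_filter.1 hi).2
    have hPi := hPK i
    have hxi := hx i
    rw [hsome, Finset.prod_insertNone, hevA,
      Finset.prod_univ_erase_mul_of_filter (p := fun j => m j = 0) hmi]
    have e1 : ∏ j ∈ Y, (P j * v (some i) + x j) ^ (m j - 1) =
        ∏ j ∈ Y, (x j - P j * x i / P i) ^ ((m j : ℤ) - 1) := by
      refine Finset.prod_congr rfl fun j hj => ?_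
      rw [hzpow j hj]
      congr 1
      simp only [v, Option.elim]
      ring
    have e2 : (∏ j ∈ Z.erase i, (P j : K)⁻¹) *
        ∏ j ∈ Z.erase i, (v (some i) - v (some j))⁻¹ =
        ∏ j ∈ Z.erase i, (x j - P j * x i / P i) ^ ((m j : ℤ) - 1) := by
      rw [← Finset.prod_mul_distrib]
      refine Finset.prod_congr rfl fun j hj => ?_
      have hmj : m j = 0 := (Finset.mem_filter.1 (Finset.mem_of_mem_erase hj)).2
      have hPj := hPK j
      rw [hmj, Nat.cast_zero, zero_sub, zpow_neg_one, ← mul_inv]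
      congr 1
      simp only [v, Option.elim]
      field_simp
      ring
    rw [e1, ← e2, ← Finset.mul_prod_erase Z _ hi]
    have e3 : (v (some i) - v none)⁻¹ = -(P i * (x i)⁻¹) := by
      simp only [v, Option.elim, sub_zero]
      rw [inv_neg, inv_div, div_eq_mul_inv]
    rw [e3, ← hY]
    generalize (∏ j ∈ Z.erase i, (P j : K)⁻¹) = a
    generalize ∏ j ∈ Z.erase i, (v (some i) - v (some j))⁻¹ = b
    generalize ∏ j ∈ Y, (x j - P j * x i / P i) ^ ((m j : ℤ) - 1) = c
    field_simp
  rw [Finset.sum_congr rfl h1, Finset.sum_neg_distrib, ← Finset.sum_filter]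
  ring

end

/-! ### Todd coefficients as a common denominator -/

theorem cothCoeff_of_ne_one {m : ℕ} (hm : m ≠ 1) :
    cothCoeff m = bernoulli m / (m.factorial : ℚ) := by
  simp [cothCoeff, periodicBernoulli, hm]

theorem cothCoeff_one : cothCoeff 1 = 0 := by
  simp [cothCoeff, periodicBernoulli]

theorem exists_cothCoeff_eq (m : ℕ) :
    ∃ s : ℤ, cothCoeff m = s * PowerSeries.coeff m toddSeries := by
  by_cases h : m = 1
  · exact ⟨0, by rw [h, cothCoeff_one]; simp⟩
  · refine ⟨(-1) ^ m, ?_⟩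
    rw [cothCoeff_of_ne_one h, toddSeries, PowerSeries.coeff_mk]
    push_cast
    rw [mul_left_comm, ← mul_pow]
    simp

theorem exists_ite_half_eq (m : ℕ) :
    ∃ s : ℤ, (if m = 1 then 1 / 2 else 0 : ℚ) = s * PowerSeries.coeff m toddSeries := by
  by_cases h : m = 1
  · refine ⟨1, ?_⟩
    subst h
    simp [toddSeries]
    norm_num
  · exact ⟨0, by simp [h]⟩

section
variable {ι : Type*} [Fintype ι] [DecidableEq ι]

/-- `c` clears the denominators of the coefficients of total degree `N` of the product of the Todd
series. -/
def ClearsTodd (ι : Type*) [Fintype ι] (N : ℕ) (c : ℚ) : Prop :=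
  ∀ m : ι → ℕ, ∑ i, m i = N → ∃ a : ℤ, c * ∏ i, PowerSeries.coeff (m i) toddSeries = a

-- The Todd coefficient of index `1` is `1 / 2`, and the others agree with the cotangent
-- coefficients up to sign. Both series allowed in `ClearsCoth` are therefore integer multiples of
-- the Todd series, coefficient by coefficient.
omit [DecidableEq ι] in
theorem ClearsTodd.clearsCoth {N : ℕ} {c : ℚ} (hc : ClearsTodd ι N c) {K : Type*} [Field K]
    [CharZero K] (O : Subring K) : ClearsCoth O ι N (c : K) := by
  intro m hm t ht
  obtain ⟨a, ha⟩ := hc m hm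
  have : ∀ i, ∃ s : ℤ, t i = s * ((PowerSeries.coeff (m i) toddSeries : ℚ) : K) := by
    intro i
    rcases ht i with h | h
    · obtain ⟨s, hs⟩ := exists_cothCoeff_eq (m i)
      exact ⟨s, by rw [h, hs]; push_cast; rfl⟩
    · obtain ⟨s, hs⟩ := exists_ite_half_eq (m i)
      refine ⟨s, ?_⟩
      rw [h]
      have := congrArg (Rat.cast : ℚ → K) hs
      rw [apply_ite (Rat.cast : ℚ → K)] at this
      push_cast at this
      exact this
  choose s hs using this
  rw [Finset.prod_congr rfl fun i _ => hs i, Finset.prod_mul_distrib, mul_left_comm]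
  have h1 : (c : K) * ∏ i, ((PowerSeries.coeff (m i) toddSeries : ℚ) : K) = (a : K) := by
    exact_mod_cast congrArg (Rat.cast : ℚ → K) ha
  rw [h1]
  exact mul_mem (prod_mem fun i _ => intCast_mem _ _) (intCast_mem _ _)

omit [DecidableEq ι] in
theorem ClearsTodd.exists_int_cothCoeff {N : ℕ} {c : ℚ} (hc : ClearsTodd ι N c) {m : ι → ℕ}
    (hm : ∑ i, m i = N) : ∃ a : ℤ, c * ∏ i, cothCoeff (m i) = a := by
  have := hc.clearsCoth (Int.castRingHom ℚ).range m hm (fun i => cothCoeff (m i))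
    fun i => Or.inl (by simp)
  obtain ⟨a, ha⟩ := this
  exact ⟨a, by simpa using ha.symm⟩

/-- Algebraic closedness supplies the roots of unity, and algebraic independence allows coefficients
to be compared. -/
theorem exists_isAlgClosed_algebraicIndependent.{u} (ι : Type u) :
    ∃ (K : Type u) (_ : Field K) (_ : CharZero K) (_ : IsAlgClosed K) (x : ι → K),
      AlgebraicIndependent ℚ x := by
  let F := FractionRing (MvPolynomial ι ℚ)
  have : CharZero F := charZero_of_injective_algebraMap
    (FaithfulSMul.algebraMap_injective (MvPolynomial ι ℚ) F)
  have : CharZero (AlgebraicClosure F) := charZero_of_injective_algebraMap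
    (algebraMap F (AlgebraicClosure F)).injective
  let f : MvPolynomial ι ℚ →+* AlgebraicClosure F :=
    (algebraMap F (AlgebraicClosure F)).comp (algebraMap (MvPolynomial ι ℚ) F)
  have hf : Function.Injective f := (algebraMap F (AlgebraicClosure F)).injective.comp
    (FaithfulSMul.algebraMap_injective (MvPolynomial ι ℚ) F)
  refine ⟨AlgebraicClosure F, inferInstance, inferInstance, inferInstance,
    fun i => f (MvPolynomial.X i), ?_⟩
  have h : ∀ p : MvPolynomial ι ℚ, MvPolynomial.aeval (fun i => f (MvPolynomial.X i)) p = f p := by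
    intro p
    induction p using MvPolynomial.induction_on with
    | C a => rw [MvPolynomial.aeval_C, eq_ratCast, ← eq_ratCast (f.comp MvPolynomial.C) a]; rfl
    | add p q hp hq => rw [map_add, map_add, hp, hq]
    | mul_X p i hp => rw [map_mul, map_mul, hp, MvPolynomial.aeval_X]
  intro p q hpq
  exact hf (by rw [← h, ← h, hpq])

section
variable {K : Type*} [Field K] [CharZero K] {ℓ : ℕ} {hℓ : ℓ.Prime} {x : ι → K}

-- Multiplication by the unit `∏ i, x i` turns the sum into a polynomial, to which Gauss's lemma
-- applies.
open MvPolynomial in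
theorem coeff_mem_of_sum_mem_gaussSubring (hx : AlgebraicIndependent ℚ x) {N : ℕ}
    (v : (ι → ℕ) → ℚ) (h : ∑ r ∈ Finset.piAntidiag Finset.univ N,
      (v r : K) * ∏ i, x i ^ ((r i : ℤ) - 1) ∈ gaussSubring hℓ x) {r : ι → ℕ}
    (hr : ∑ i, r i = N) : v r ∈ rationalsAt hℓ := by
  have hu := (unimodular_gaussSubring (hℓ := hℓ) hx).isUnitIn hℓ
  have h1 := mul_mem h (prod_mem fun i (_ : i ∈ Finset.univ) => (hu i).2.1)
  set g : MvPolynomial ι ℚ := ∑ r ∈ Finset.piAntidiag Finset.univ N,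
    monomial (Finsupp.equivFunOnFinite.symm r) (v r) with hg
  have h2 : aeval x g = (∑ r ∈ Finset.piAntidiag Finset.univ N,
      (v r : K) * ∏ i, x i ^ ((r i : ℤ) - 1)) * ∏ i, x i := by
    rw [hg, map_sum, Finset.sum_mul]
    refine Finset.sum_congr rfl fun r _ => ?_
    rw [aeval_monomial, mul_assoc, ← Finset.prod_mul_distrib, Finsupp.prod_fintype _ _ (by simp)]
    congr 1
    refine Finset.prod_congr rfl fun i _ => ?_
    rw [zpow_sub_one₀ (hu i).1, zpow_natCast, inv_mul_cancel_right₀ (hu i).1]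
    rfl
  rw [← h2] at h1
  have h3 := coeff_mem_of_aeval_mem_gaussSubring hx h1 (Finsupp.equivFunOnFinite.symm r)
  rw [hg, coeff_sum, Finset.sum_eq_single r] at h3
  · simpa using h3
  · intro b _ hb
    rw [coeff_monomial, if_neg]
    exact fun he => hb (Finsupp.equivFunOnFinite.symm.injective he)
  · intro hn
    exact absurd (by simpa using hr) hn

end

/-! ### Local integrality and the local congruence -/

/-- Integrality of the normalized Dedekind sums at primes that do not divide the modulus. -/
theorem mul_dedekindCoeff_mem_rationalsAt {ℓ : ℕ} (hℓ : ℓ.Prime) {N : ℕ} {c : ℚ}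
    (hc : ClearsTodd ι N c) {Q : ℕ} (hQ : ¬ ℓ ∣ Q) (P : ι → ℕ) {r : ι → ℕ}
    (hr : ∑ i, r i = N) : c * dedekindCoeff Q P r ∈ rationalsAt hℓ := by
  obtain ⟨K, _, _, _, x, hx⟩ := exists_isAlgClosed_algebraicIndependent ι
  have hu := unimodular_gaussSubring (hℓ := hℓ) hx
  have hQ0 : 0 < Q := Nat.pos_of_ne_zero fun h => hQ (h ▸ dvd_zero _)
  have h := cothSum_mem_integralAt hℓ (inv_intCast_mem_gaussSubring hx)
    (hc.clearsCoth (gaussSubring hℓ x)) Q hQ P x hu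
  rw [mem_integralAt, coeff_cothSum hQ0 P x fun i => (hu.isUnitIn hℓ i).1, Finset.mul_sum] at h
  refine coeff_mem_of_sum_mem_gaussSubring hx (fun r => c * dedekindCoeff Q P r) ?_ hr
  convert h using 2
  push_cast
  ring

/-- The distribution relation of the Bernoulli functions: for every `Q`, the generating function at
`w = 1` is `z * cothFun (exp z)`. -/
theorem bernoulliFourier_one {Q : ℕ} (hQ : 0 < Q) (K : Type*) [Field K] [CharZero K] (r : ℕ) :
    bernoulliFourier Q r (1 : K) = cothCoeff r := by
  have h1 := single_mul_cothFun hQ (one_pow Q : (1 : K) ^ Q = 1) (one_ne_zero (α := K))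
  have h2 := single_mul_cothFun_expLaurent (one_ne_zero (α := K))
  have hC : (HahnSeries.C (1 : K) : LaurentSeries K) = 1 := map_one _
  rw [hC, one_mul, h2] at h1
  have := congrArg (PowerSeries.coeff r) (HahnSeries.ofPowerSeries_injective h1)
  simpa using this.symm

theorem bernoulliFourier_zero {Q : ℕ} {K : Type*} [Field K] [CharZero K] {w : K}
    (hw : w ^ Q = 1) (hw1 : w ≠ 1) : bernoulliFourier Q 0 w = 0 := by
  have h : bernoulliFourier Q 0 w = (∑ k ∈ Finset.range Q, w ^ k) * (Q : K)⁻¹ := by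
    rw [bernoulliFourier, Finset.sum_mul]
    refine Finset.sum_congr rfl fun k _ => ?_
    simp [bernoulliWeight, periodicBernoulli]
  have h2 := geom_sum_mul w Q
  rw [hw, sub_self] at h2
  rw [h, (mul_eq_zero.1 h2).resolve_right (sub_ne_zero.2 hw1), zero_mul]

/-- The factor of index `i` is the Fourier transform of a constant, so it vanishes unless `w ^ P i =
1`. Coprimality then forces `w = 1`. -/
theorem dedekindCoeff_of_eq_zero {Q : ℕ} (hQ : 0 < Q) {P r : ι → ℕ} {i : ι} (hi : r i = 0)
    (hP : Nat.Coprime (P i) Q) : dedekindCoeff Q P r = ∏ i, cothCoeff (r i) := by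
  have h := sum_prod_bernoulliFourier (K := AlgebraicClosure ℚ) hQ P r
  rw [Finset.sum_eq_single 1] at h
  · simp only [one_pow, bernoulliFourier_one hQ] at h
    exact_mod_cast h.symm
  · intro w hw hw1
    rw [Polynomial.mem_nthRootsFinset hQ] at hw
    refine Finset.prod_eq_zero (Finset.mem_univ i) ?_
    rw [hi]
    refine bernoulliFourier_zero (by rw [← pow_mul, mul_comm, pow_mul, hw, one_pow]) fun h1 => ?_
    have h2 := pow_gcd_eq_one.2 ⟨h1, hw⟩
    rw [Nat.Coprime.gcd_eq_one hP, pow_one] at h2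
    exact hw1 h2
  · intro h1
    exact absurd ((Polynomial.mem_nthRootsFinset hQ _).2 (one_pow _)) h1

end

section
variable {ι : Type*} [Fintype ι] [DecidableEq ι]

/-- The contribution of the `i`-th weight to the reciprocity law, modulo `q`. -/
theorem reciprocal_term_mem {K : Type*} [Field K] [CharZero K] {ℓ : ℕ} {hℓ : ℓ.Prime} {x : ι → K}
    (hx : AlgebraicIndependent ℚ x) {N : ℕ} {c : ℚ} (hc : ClearsTodd ι N c) {q : ℕ} (hq : 0 < q)
    {P : ι → ℕ} {i : ι} (hPℓ : ¬ ℓ ∣ P i) (hP : Nat.Coprime q (P i))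
    (hU : ∀ j, j ≠ i → IsUnitIn (gaussSubring hℓ x) (x j - P j * x i / P i)) {r : ι → ℕ}
    (hr : ∑ i, r i = N) :
    (P i : K)⁻¹ * (c * ((dedekindCoeff (P i) (Function.update P i q) r : K) *
        ∏ j, reciprocalForms q P x i j ^ ((r j : ℤ) - 1))) +
      (if r i = 0 then (c * ∏ j, (cothCoeff (r j) : K)) * ((x i)⁻¹ *
        ∏ j ∈ Finset.univ.erase i, (x j - P j * x i / P i) ^ ((r j : ℤ) - 1)) else 0) / q ∈
      gaussSubring hℓ x := by
  have hP0 : 0 < P i := Nat.pos_of_ne_zero fun h => hPℓ (h ▸ dvd_zero _)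
  have hPK : (P i : K) ≠ 0 := by exact_mod_cast hP0.ne'
  have hqK : (q : K) ≠ 0 := by exact_mod_cast hq.ne'
  have hxi := (unimodular_gaussSubring (hℓ := hℓ) hx).isUnitIn hℓ i
  have hPi : (P i : K)⁻¹ ∈ gaussSubring hℓ x := by
    exact_mod_cast inv_intCast_mem_gaussSubring (hℓ := hℓ) hx (P i)
      fun h => hPℓ (Int.natCast_dvd_natCast.1 h)
  have hprod : ∏ j, reciprocalForms q P x i j ^ ((r j : ℤ) - 1) =
      (-(q * x i / P i)) ^ ((r i : ℤ) - 1) *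
        ∏ j ∈ Finset.univ.erase i, (x j - P j * x i / P i) ^ ((r j : ℤ) - 1) := by
    rw [← Finset.mul_prod_erase _ _ (Finset.mem_univ i), reciprocalForms, Function.update_self]
    congr 1
    refine Finset.prod_congr rfl fun j hj => ?_
    rw [Function.update_of_ne (Finset.ne_of_mem_erase hj)]
  rw [hprod]
  by_cases h0 : r i = 0
  -- The exponent `-1` on `-(q * x i / P i)` produces a `1 / q`, and the two summands cancel
  -- exactly.
  · rw [if_pos h0, dedekindCoeff_of_eq_zero hP0 h0 (by rwa [Function.update_self]), h0]
    push_cast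
    convert zero_mem (gaussSubring hℓ x) using 1
    have := hxi.1
    rw [zpow_neg_one]
    field_simp
    ring
  -- Now the exponent on `-(q * x i / P i)` is nonnegative, so every factor is integral at `ℓ`.
  · rw [if_neg h0, zero_div, add_zero]
    refine mul_mem hPi ?_
    rw [← mul_assoc]
    refine mul_mem ?_ (mul_mem ?_ (prod_mem fun j hj =>
      (hU j (Finset.ne_of_mem_erase hj)).zpow_mem _))
    · exact_mod_cast ratCast_mem_gaussSubring hx
        (mul_dedekindCoeff_mem_rationalsAt hℓ hc hPℓ (Function.update P i q) hr)
    · rw [← Nat.cast_one, ← Nat.cast_sub (Nat.one_le_iff_ne_zero.2 h0), zpow_natCast]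
      refine pow_mem (neg_mem ?_) _
      rw [div_eq_mul_inv]
      exact mul_mem (mul_mem (natCast_mem _ _) hxi.2.1) hPi

/-- The normalized Dedekind sums modulo `q`. -/
theorem dedekindCoeff_congr {ℓ : ℕ} (hℓ : ℓ.Prime) {N : ℕ} {c : ℚ} (hc : ClearsTodd ι N c)
    {q : ℕ} (hq : 0 < q) (hℓq : ℓ ∣ q) {P : ι → ℕ} (hP : ∀ i, Nat.Coprime q (P i)) {r : ι → ℕ}
    (hr : ∑ i, r i = N) (hr0 : ∀ i, r i ≠ 0) :
    (c * dedekindCoeff q P r +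
      ∑ m ∈ (Finset.piAntidiag Finset.univ N).filter (fun m => ∃ i, m i = 0),
        (c * ∏ i, cothCoeff (m i)) * ∏ i, shiftedBinomial (P i) (m i) (r i)) / q ∈
      rationalsAt hℓ := by
  obtain ⟨K, _, _, _, x, hx⟩ := exists_isAlgClosed_algebraicIndependent ι
  have hu := unimodular_gaussSubring (hℓ := hℓ) hx
  have hqK : (q : K) ≠ 0 := by exact_mod_cast hq.ne'
  have hPℓ : ∀ i, ¬ ℓ ∣ P i := fun i h =>
    hℓ.one_lt.ne' (Nat.dvd_one.1 (Nat.Coprime.gcd_eq_one (hP i) ▸ Nat.dvd_gcd hℓq h))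
  have hP0 : ∀ i, P i ≠ 0 := fun i h => hPℓ i (h ▸ dvd_zero _)
  have hx0 : ∀ i, x i ≠ 0 := fun i => (hu.isUnitIn hℓ i).1
  have hU : ∀ i j, j ≠ i → IsUnitIn (gaussSubring hℓ x) (x j - P j * x i / P i) := by
    intro i j hij
    -- The forms with `j ≠ i` do not involve the modulus. The value `1` replaces `q`, which is
    -- divisible by `ℓ`.
    have h := (hu.reciprocalForms hℓ (inv_intCast_mem_gaussSubring hx) (Q := 1)
      (fun h => hℓ.one_lt.ne' (Nat.dvd_one.1 h)) (hPℓ i)).isUnitIn hℓ j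
    rwa [reciprocalForms, Function.update_of_ne hij] at h
  have hR0 : ∀ i j, reciprocalForms q P x i j ≠ 0 := by
    intro i j
    rw [reciprocalForms]
    by_cases hij : j = i
    · subst hij
      rw [Function.update_self]
      exact neg_ne_zero.2 (div_ne_zero (mul_ne_zero hqK (hx0 j)) (by exact_mod_cast hP0 j))
    · rw [Function.update_of_ne hij]
      exact (hU i j hij).1
  set S := Finset.piAntidiag (Finset.univ : Finset ι) N with hS
  have hmemS : ∀ {m}, m ∈ S → ∑ i, m i = N := fun hm => by simpa [hS] using hm
  set τ : (ι → ℕ) → K := fun m => c * ∏ j, (cothCoeff (m j) : K) with hτ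
  set L : ι → (ι → ℕ) → K := fun i m => if m i = 0 then
    (x i)⁻¹ * ∏ j ∈ Finset.univ.erase i, (x j - P j * x i / P i) ^ ((m j : ℤ) - 1) else 0 with hL
  have hrec := cothSum_eq hq P x hx0 fun i j hij _ => (hU i j hij.symm).1
  have hbd := boundary_mem_integralAt (hc.clearsCoth (gaussSubring hℓ x)) P fun i => hu.isUnitIn hℓ i
  rw [mem_integralAt] at hbd
  set bd := (1 / 2 * ((∏ i, if P i = 0 then cothFun (expLaurent (x i)) else 1 / 2) +
    ∏ i, if P i = 0 then cothFun (expLaurent (x i)) else -(1 / 2)) : LaurentSeries K)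
  have hcoef := congrArg (fun f => HahnSeries.coeff f ((N : ℤ) - Fintype.card ι)) hrec
  simp only [HahnSeries.C_mul_eq_smul, HahnSeries.coeff_smul, HahnSeries.coeff_sub,
    HahnSeries.coeff_sum, smul_eq_mul] at hcoef
  have hci := fun i => coeff_cothSum (Nat.pos_of_ne_zero (hP0 i)) (Function.update P i q)
    (reciprocalForms q P x i) (hR0 i) N
  rw [coeff_cothSum hq P x hx0] at hcoef
  simp only [hci] at hcoef
  -- The factor `q` in front of the reciprocity law makes the boundary and all integral terms vanish
  -- modulo `q`, leaving only the terms with exponent `-1`.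
  have hmain : (c * ∑ r ∈ S, (dedekindCoeff q P r : K) * ∏ i, x i ^ ((r i : ℤ) - 1) -
      ∑ i, ∑ m ∈ S, τ m * L i m) / q ∈ gaussSubring hℓ x := by
    have h1 := sub_mem hbd (sum_mem fun i (_ : i ∈ Finset.univ) => sum_mem fun m (hm : m ∈ S) =>
      reciprocal_term_mem hx hc hq (hPℓ i) (hP i) (hU i) (hmemS hm))
    convert h1 using 1
    rw [hcoef]
    simp only [Finset.sum_add_distrib, ← Finset.mul_sum, ← Finset.sum_div]
    have h2 : ∀ i m, (if m i = 0 then (c * ∏ j, (cothCoeff (m j) : K)) * ((x i)⁻¹ *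
        ∏ j ∈ Finset.univ.erase i, (x j - P j * x i / P i) ^ ((m j : ℤ) - 1)) else 0) =
        τ m * L i m := by
      intro i m
      simp only [hτ, hL, mul_ite, mul_zero]
    simp only [h2]
    rw [sub_div, mul_left_comm, mul_div_cancel_left₀ _ hqK, mul_sub, Finset.mul_sum, sub_sub]
    congr 2
    refine Finset.sum_congr rfl fun i _ => ?_
    ring
  have hpf : ∑ i, ∑ m ∈ S, τ m * L i m = ∑ m ∈ S.filter (fun m => ∃ i, m i = 0),
      τ m * (∏ i, x i ^ ((m i : ℤ) - 1) - ∑ r ∈ S,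
        ∏ i, (shiftedBinomial (P i) (m i) (r i) : K) * x i ^ ((r i : ℤ) - 1)) := by
    rw [Finset.sum_comm, ← Finset.sum_filter_of_ne (p := fun m => ∃ i, m i = 0)]
    · refine Finset.sum_congr rfl fun m hm => ?_
      rw [← Finset.mul_sum, ← partial_fractions P hP0 x hx0
        (fun i j hij => (hU i j hij.symm).1) m (hmemS (Finset.mem_filter.1 hm).1)]
    · intro m _ hne
      obtain ⟨i, -, hi⟩ := Finset.exists_ne_zero_of_sum_ne_zero hne
      by_contra hno
      push Not at hno
      exact hi (by simp only [hL, if_neg (hno i), mul_zero])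
  -- These are the coefficients after partial fractions. The middle term comes from the pole at `0`
  -- and disappears when no `r i` is zero.
  set v : (ι → ℕ) → ℚ := fun r => (c * dedekindCoeff q P r -
    (if ∃ i, r i = 0 then c * ∏ i, cothCoeff (r i) else 0) +
      ∑ m ∈ S.filter (fun m => ∃ i, m i = 0),
        (c * ∏ i, cothCoeff (m i)) * ∏ i, shiftedBinomial (P i) (m i) (r i)) / q with hv
  have hfin := coeff_mem_of_sum_mem_gaussSubring (hℓ := hℓ) hx (N := N) v (by
    convert hmain using 1
    rw [hpf]
    have hvr : ∀ r, (v r : K) * ∏ i, x i ^ ((r i : ℤ) - 1) =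
        (c * ((dedekindCoeff q P r : K) * ∏ i, x i ^ ((r i : ℤ) - 1)) -
          (if ∃ i, r i = 0 then τ r * ∏ i, x i ^ ((r i : ℤ) - 1) else 0) +
          ∑ m ∈ S.filter (fun m => ∃ i, m i = 0), τ m *
            ∏ i, (shiftedBinomial (P i) (m i) (r i) : K) * x i ^ ((r i : ℤ) - 1)) / q := by
      intro r
      simp only [hv, hτ, Finset.prod_mul_distrib, ← mul_assoc, ← Finset.sum_mul]
      split_ifs <;> push_cast <;> ring
    rw [Finset.sum_congr rfl fun r _ => hvr r, ← Finset.sum_div]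
    congr 1
    rw [Finset.sum_add_distrib, Finset.sum_sub_distrib, ← Finset.sum_filter, Finset.sum_comm,
      Finset.mul_sum]
    simp only [mul_sub, Finset.sum_sub_distrib, ← Finset.mul_sum]
    ring) hr
  simp only [hv] at hfin
  rwa [if_neg (by push Not; exact hr0), sub_zero] at hfin

end

/-! ### From symmetric sums to the stated congruence -/

theorem clearsTodd_toddDenominator (N n : ℕ) :
    ClearsTodd (Fin n) N (toddDenominator N n : ℚ) := by
  intro m hm
  have hcoeff : (toddPolynomial n N).coeff (Finsupp.equivFunOnFinite.symm m) =
      ∏ i, PowerSeries.coeff (m i) toddSeries := by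
    rw [toddPolynomial, MvPolynomial.coeff_sum, Finset.sum_eq_single m]
    · simp
    · intro b _ hb
      rw [MvPolynomial.coeff_monomial, if_neg]
      exact fun he => hb (Finsupp.equivFunOnFinite.symm.injective he)
    · intro hn
      exact absurd (by simpa using hm) hn
  rw [← hcoeff]
  by_cases h0 : (toddPolynomial n N).coeff (Finsupp.equivFunOnFinite.symm m) = 0
  · exact ⟨0, by rw [h0]; simp⟩
  · obtain ⟨e, he⟩ : ((toddPolynomial n N).coeff (Finsupp.equivFunOnFinite.symm m)).den ∣
        toddDenominator N n := Finset.dvd_lcm (f := fun m => ((toddPolynomial n N).coeff m).den)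
          (MvPolynomial.mem_support_iff.2 h0)
    refine ⟨e * ((toddPolynomial n N).coeff (Finsupp.equivFunOnFinite.symm m)).num, ?_⟩
    rw [he]
    push_cast
    rw [← Rat.mul_den_eq_num]
    ring

theorem periodicBernoulli_add_intCast (k : ℕ) (t : ℚ) (z : ℤ) :
    periodicBernoulli k (t + z) = periodicBernoulli k t := by
  simp [periodicBernoulli]

/-- As the last weight is `-1` modulo `q`, the divisibility condition determines the last index as
`∑ i, p i * k i` modulo `q`. The powers of `q` combine to `1 + ∑ i, (r i - 1)`. -/
theorem dedekindCoeff_eq_generalizedDedekindSum {n : ℕ} {r : Fin (n + 1) → ℕ}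
    (hr : ∀ i, 1 ≤ r i) {q : ℕ} (hq : 0 < q) {p : Fin n → ℤ} {P : Fin (n + 1) → ℕ}
    (hP : ∀ i, (P i : ℤ) ≡ (Fin.snoc p (-1) : Fin (n + 1) → ℤ) i [ZMOD q]) :
    dedekindCoeff q P r = (q : ℚ) ^ (∑ i, r i - n) * generalizedDedekindSum r q p /
      ∏ i, ((r i).factorial : ℚ) := by
  have hqQ : (q : ℚ) ≠ 0 := by exact_mod_cast hq.ne'
  have hqZ : (0 : ℤ) < q := by exact_mod_cast hq
  have hpow : (q : ℚ) * ∏ i, (q : ℚ) ^ ((r i : ℤ) - 1) = (q : ℚ) ^ (∑ i, r i - n) := by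
    have h1 : ∀ i, (q : ℚ) ^ ((r i : ℤ) - 1) = (q : ℚ) ^ (r i - 1) := fun i => by
      rw [← Nat.cast_one, ← Nat.cast_sub (hr i), zpow_natCast]
    rw [Finset.prod_congr rfl fun i _ => h1 i, Finset.prod_pow_eq_pow_sum, ← pow_succ']
    congr 1
    have h2 : ∑ i, r i = ∑ i, (r i - 1) + (n + 1) := by
      rw [← Finset.sum_congr rfl fun i _ => Nat.sub_add_cancel (hr i), Finset.sum_add_distrib]
      simp
    omega
  have hweight : ∀ k : Fin (n + 1) → Fin q, ∏ i, bernoulliWeight q (r i) (k i) =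
      (∏ i, (q : ℚ) ^ ((r i : ℤ) - 1)) *
        (∏ i, periodicBernoulli (r i) (((k i : ℕ) : ℚ) / q)) / ∏ i, ((r i).factorial : ℚ) := by
    intro k
    simp only [bernoulliWeight]
    rw [Finset.prod_mul_distrib, Finset.prod_div_distrib, mul_div_assoc]
  have hsum : (∑ k : Fin (n + 1) → Fin q, if q ∣ ∑ i, P i * (k i : ℕ) then
      ∏ i, periodicBernoulli (r i) (((k i : ℕ) : ℚ) / q) else 0) =
      generalizedDedekindSum r q p := by
    rw [← Equiv.sum_comp (Fin.snocEquiv fun _ => Fin q), Fintype.sum_prod_type_right,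
      generalizedDedekindSum]
    refine Finset.sum_congr rfl fun k _ => ?_
    set s : ℤ := ∑ i, p i * (k i : ℕ) with hs
    have hlt : (s % q).toNat < q := by
      have := Int.emod_lt_of_pos s hqZ
      have := Int.emod_nonneg s hqZ.ne'
      omega
    have hnn : ((s % q).toNat : ℤ) = s % q := Int.toNat_of_nonneg (Int.emod_nonneg s hqZ.ne')
    have hdvd : ∀ a : Fin q, q ∣ ∑ i, P i * ((Fin.snoc (α := fun _ => Fin q) k a : Fin (n + 1) →
        Fin q) i : ℕ) ↔ (a : ℕ) = (s % q).toNat := by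
      intro a
      rw [← Int.natCast_dvd_natCast, ← Int.modEq_zero_iff_dvd, Fin.sum_univ_castSucc]
      simp only [Fin.snoc_castSucc, Fin.snoc_last]
      push_cast
      have h1 : ∑ i : Fin n, (P i.castSucc : ℤ) * (k i : ℕ) + P (Fin.last n) * (a : ℕ) ≡
          s + (-1) * (a : ℕ) [ZMOD q] := by
        refine Int.ModEq.add ?_ ?_
        · rw [hs]
          refine Int.ModEq.sum fun i _ => ?_
          have := hP i.castSucc
          rw [Fin.snoc_castSucc] at this
          exact this.mul_right _
        · have := hP (Fin.last n)
          rw [Fin.snoc_last] at this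
          exact this.mul_right _
      have h2 : s + (-1) * ((a : ℕ) : ℤ) ≡ 0 [ZMOD q] ↔ s % q = ((a : ℕ) : ℤ) := by
        have ha : (((a : ℕ) : ℤ)) % q = ((a : ℕ) : ℤ) :=
          Int.emod_eq_of_lt (by positivity) (by exact_mod_cast a.2)
        rw [Int.modEq_zero_iff_dvd, neg_one_mul, ← sub_eq_add_neg, ← Int.modEq_iff_dvd,
          Int.ModEq, ha, eq_comm]
      rw [show (∑ i : Fin n, (P i.castSucc : ℤ) * (k i : ℕ) + P (Fin.last n) * (a : ℕ) ≡
        0 [ZMOD q]) ↔ _ from ⟨fun h => h1.symm.trans h, fun h => h1.trans h⟩, h2, ← hnn]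
      exact_mod_cast eq_comm
    simp only [Fin.snocEquiv_apply]
    rw [Finset.sum_eq_single (⟨(s % q).toNat, hlt⟩ : Fin q)]
    · rw [if_pos ((hdvd _).2 rfl), Fin.prod_univ_castSucc]
      simp only [Fin.snoc_castSucc, Fin.snoc_last]
      congr 1
      have h3 : (∑ i : Fin n, (p i : ℚ) * ((k i : ℕ) : ℚ)) / q =
          (((s % q).toNat : ℕ) : ℚ) / q + ((s / q : ℤ) : ℚ) := by
        have h4 : (∑ i : Fin n, (p i : ℚ) * ((k i : ℕ) : ℚ)) = (s : ℚ) := by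
          rw [hs]
          push_cast
          rfl
        have h5 : (((s % q).toNat : ℕ) : ℚ) = ((s % q : ℤ) : ℚ) := by
          exact_mod_cast congrArg (Int.cast : ℤ → ℚ) hnn
        rw [h4, h5]
        have h6 : (s : ℚ) = q * ((s / q : ℤ) : ℚ) + ((s % q : ℤ) : ℚ) := by
          exact_mod_cast (Int.mul_ediv_add_emod s q).symm
        field_simp
        linear_combination h6
      rw [h3, periodicBernoulli_add_intCast]
    · intro b _ hb
      rw [if_neg]
      exact fun h => hb (Fin.ext ((hdvd b).1 h))
    · intro h
      exact absurd (Finset.mem_univ _) h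
  rw [dedekindCoeff, ← hsum, ← hpow]
  simp only [hweight]
  rw [Finset.mul_sum, mul_div_assoc, Finset.sum_div, Finset.mul_sum]
  refine Finset.sum_congr rfl fun k _ => ?_
  split_ifs <;> ring

theorem prod_sub_prod_div_mem {K ι : Type*} [Field K] (O : Subring K) (s : Finset ι) (q : K)
    (x y : ι → K) (hx : ∀ i, x i ∈ O) (hy : ∀ i, y i ∈ O) (h : ∀ i, (x i - y i) / q ∈ O) :
    (∏ i ∈ s, x i - ∏ i ∈ s, y i) / q ∈ O := by
  classical
  induction s using Finset.induction_on with
  | empty => simp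
  | insert a s ha ih =>
    rw [Finset.prod_insert ha, Finset.prod_insert ha]
    have : (x a * ∏ i ∈ s, x i - y a * ∏ i ∈ s, y i) / q =
        (x a - y a) / q * ∏ i ∈ s, x i + y a * ((∏ i ∈ s, x i - ∏ i ∈ s, y i) / q) := by ring
    rw [this]
    exact add_mem (mul_mem (h a) (prod_mem fun i _ => hx i)) (mul_mem (hy a) ih)

section
variable {ℓ : ℕ} {hℓ : ℓ.Prime} {q P : ℕ} {p p' : ℤ}

theorem natCast_zpow_mem_rationalsAt (hP : ¬ ℓ ∣ P) (e : ℤ) :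
    (P : ℚ) ^ e ∈ rationalsAt hℓ := by
  obtain ⟨k, rfl | rfl⟩ := e.eq_nat_or_neg
  · rw [zpow_natCast]
    exact pow_mem (natCast_mem _ _) k
  · rw [zpow_neg, zpow_natCast, ← inv_pow]
    refine pow_mem ?_ k
    exact_mod_cast inv_mem_rationalsAt (hℓ := hℓ) (b := (P : ℤ))
      fun h => hP (Int.natCast_dvd_natCast.1 h)

/-- For `e = -k` the difference is `P ^ (-k) * (1 - (P * p') ^ k)`, and `q` divides the second
factor. -/
theorem zpow_sub_powWithInverse_div_mem (hq : 0 < q) (hP : ¬ ℓ ∣ P)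
    (hPp : (P : ℤ) ≡ p [ZMOD q]) (hpp' : p * p' ≡ 1 [ZMOD q]) (e : ℤ) :
    ((P : ℚ) ^ e - (powWithInverse p p' e : ℤ)) / q ∈ rationalsAt hℓ := by
  have hqQ : (q : ℚ) ≠ 0 := by exact_mod_cast hq.ne'
  rw [powWithInverse]
  split_ifs with he
  · obtain ⟨k, rfl⟩ := Int.eq_ofNat_of_zero_le he
    obtain ⟨z, hz⟩ := (hPp.pow k).symm.dvd
    have : ((P : ℚ) ^ (k : ℤ) - ((p ^ (k : ℤ).toNat : ℤ) : ℚ)) / q = (z : ℚ) := by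
      rw [Int.toNat_natCast, zpow_natCast, div_eq_iff hqQ, mul_comm]
      exact_mod_cast hz
    rw [this]
    exact intCast_mem _ _
  · obtain ⟨k, hk⟩ := Int.eq_ofNat_of_zero_le (by omega : 0 ≤ -e)
    have hek : e = -(k : ℤ) := by omega
    subst hek
    have h1 : ((P : ℤ) * p') ^ k ≡ 1 [ZMOD q] := by
      have := ((hPp.mul_right p').trans hpp').pow k
      rwa [one_pow] at this
    obtain ⟨z, hz⟩ := h1.dvd
    have hP0 : (P : ℚ) ≠ 0 := by
      intro h
      rw [Nat.cast_eq_zero] at h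
      exact hP (h ▸ dvd_zero _)
    have : ((P : ℚ) ^ (-(k : ℤ)) - ((p' ^ (- -(k : ℤ)).toNat : ℤ) : ℚ)) / q =
        (P : ℚ) ^ (-(k : ℤ)) * z := by
      rw [neg_neg, Int.toNat_natCast, zpow_neg, zpow_natCast, div_eq_iff hqQ]
      have h2 : (1 : ℚ) - ((P : ℚ) * p') ^ k = q * z := by exact_mod_cast hz
      rw [mul_assoc, mul_comm (z : ℚ), ← h2, mul_sub, mul_pow, mul_one,
        inv_mul_cancel_left₀ (pow_ne_zero _ hP0)]
      push_cast
      rfl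
    rw [this]
    exact mul_mem (natCast_zpow_mem_rationalsAt hP _) (intCast_mem _ _)

theorem shiftedBinomial_mem_rationalsAt (hP : ¬ ℓ ∣ P) (m r : ℕ) :
    shiftedBinomial P m r ∈ rationalsAt hℓ := by
  rw [shiftedBinomial]
  split_ifs
  · exact zero_mem _
  · exact mul_mem (intCast_mem _ _) (natCast_zpow_mem_rationalsAt hP _)

end

theorem prod_cothCoeff_eq_zero {ι : Type*} [Fintype ι] {m : ι → ℕ} (h : ¬ ∀ i, Even (m i)) :
    ∏ i, cothCoeff (m i) = 0 := by
  push Not at h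
  obtain ⟨i, hi⟩ := h
  refine Finset.prod_eq_zero (Finset.mem_univ i) ?_
  by_cases h1 : m i = 1
  · rw [h1, cothCoeff_one]
  · rw [cothCoeff_of_ne_one h1, bernoulli_eq_zero_of_odd (Nat.not_even_iff_odd.1 hi) (by
      rcases Nat.not_even_iff_odd.1 hi with ⟨k, hk⟩
      omega), zero_div]

theorem prod_cothCoeff_of_even {ι : Type*} [Fintype ι] {m : ι → ℕ} (h : ∀ i, Even (m i)) :
    ∏ i, cothCoeff (m i) = ∏ i, bernoulli (m i) / ((m i).factorial : ℚ) := by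
  refine Finset.prod_congr rfl fun i _ => cothCoeff_of_ne_one fun h1 => ?_
  have := h i
  rw [h1] at this
  exact absurd this (by decide)

theorem mainTheorem1 (n : ℕ) (r : Fin (n + 1) → ℕ) (hr : ∀ i, 1 ≤ r i) (N : ℕ)
    (hN : N = ∑ i, r i) (q : ℕ) (hq : 1 ≤ q) (p : Fin n → ℤ)
    (hp : ∀ i, IsCoprime (p i) (q : ℤ)) :
    ∃ a : ℤ,
      (a : ℚ) = (toddDenominator N (n + 1) : ℚ) * (q : ℚ) ^ (N - n) *
        generalizedDedekindSum r q p / ∏ i, ((r i).factorial : ℚ) ∧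
      ∀ p' : Fin n → ℤ, (∀ i, p i * p' i ≡ 1 [ZMOD (q : ℤ)]) →
        ∃ b : ℤ,
          (b : ℚ) = ∑ m ∈ evenIndices (n + 1) N,
            (-(toddDenominator N (n + 1) : ℚ)) *
              (∏ i, bernoulli (m i) / ((m i).factorial : ℚ)) *
              ∏ i, ((Ring.choose ((m i : ℤ) - 1) (r i - 1) *
                powWithInverse ((Fin.snoc p (-1) : Fin (n + 1) → ℤ) i)
                  ((Fin.snoc p' (-1) : Fin (n + 1) → ℤ) i) ((m i : ℤ) - (r i : ℤ)) : ℤ) : ℚ) ∧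
          a ≡ b [ZMOD (q : ℤ)] := by
  set d : ℚ := ((toddDenominator N (n + 1) : ℕ) : ℚ) with hd
  have hc : ClearsTodd (Fin (n + 1)) N d := clearsTodd_toddDenominator N (n + 1)
  have hqZ : (0 : ℤ) < q := by exact_mod_cast hq
  have hqQ : (q : ℚ) ≠ 0 := by exact_mod_cast (Nat.pos_of_ne_zero (by omega)).ne'
  have hr0 : ∀ i, r i ≠ 0 := fun i => by have := hr i; omega
  -- Natural representatives are needed because the weights serve as moduli after reciprocity.
  set P : Fin (n + 1) → ℕ := fun i => ((Fin.snoc p (-1) : Fin (n + 1) → ℤ) i % q).toNat with hPdef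
  have hPmod : ∀ i, (P i : ℤ) ≡ (Fin.snoc p (-1) : Fin (n + 1) → ℤ) i [ZMOD q] := fun i => by
    rw [hPdef]
    simp only
    rw [Int.toNat_of_nonneg (Int.emod_nonneg _ hqZ.ne')]
    exact Int.mod_modEq _ _
  have hPcop : ∀ i, Nat.Coprime q (P i) := by
    intro i
    have h1 : IsCoprime ((Fin.snoc p (-1) : Fin (n + 1) → ℤ) i) (q : ℤ) := by
      refine Fin.lastCases ?_ (fun i => ?_) i
      · rw [Fin.snoc_last]
        exact isCoprime_one_left.neg_left
      · rw [Fin.snoc_castSucc]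
        exact hp i
    obtain ⟨z, hz⟩ := (hPmod i).dvd
    rw [show (Fin.snoc p (-1) : Fin (n + 1) → ℤ) i = P i + q * z by linear_combination hz] at h1
    exact (Nat.isCoprime_iff_coprime.1 h1.of_add_mul_left_left).symm
  have hD := dedekindCoeff_eq_generalizedDedekindSum hr hq hPmod
  rw [← hN] at hD
  have hDd : d * (q : ℚ) ^ (N - n) * generalizedDedekindSum r q p / ∏ i, ((r i).factorial : ℚ) =
      d * dedekindCoeff q P r := by rw [hD]; ring
  have hPℓ : ∀ {ℓ : ℕ}, ℓ.Prime → ℓ ∣ q → ∀ i, ¬ ℓ ∣ P i := fun hℓ hℓq i h =>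
    hℓ.one_lt.ne' (Nat.dvd_one.1 (Nat.Coprime.gcd_eq_one (hPcop i) ▸ Nat.dvd_gcd hℓq h))
  -- Cotangent coefficients of odd index vanish, including index `1`, so only even tuples remain.
  have hsum : ∑ m ∈ (Finset.piAntidiag Finset.univ N).filter (fun m => ∃ i, m i = 0),
      (d * ∏ i, cothCoeff (m i)) * ∏ i, shiftedBinomial (P i) (m i) (r i) =
      ∑ m ∈ evenIndices (n + 1) N,
        (d * ∏ i, cothCoeff (m i)) * ∏ i, shiftedBinomial (P i) (m i) (r i) := by
    symm
    refine Finset.sum_subset ?_ ?_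
    · intro m hm
      rw [evenIndices, Finset.mem_filter] at hm
      exact Finset.mem_filter.2 ⟨hm.1, hm.2.2⟩
    · intro m hm hm'
      rw [Finset.mem_filter] at hm
      rw [prod_cothCoeff_eq_zero, mul_zero, zero_mul]
      intro h
      exact hm' (Finset.mem_filter.2 ⟨hm.1, h, hm.2⟩)
  have hcong : ∀ {ℓ : ℕ} (hℓ : ℓ.Prime), ℓ ∣ q → (d * dedekindCoeff q P r +
      ∑ m ∈ evenIndices (n + 1) N,
        (d * ∏ i, cothCoeff (m i)) * ∏ i, shiftedBinomial (P i) (m i) (r i)) / q ∈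
      rationalsAt hℓ := fun hℓ hℓq => by
    rw [← hsum]
    convert dedekindCoeff_congr hℓ hc hq hℓq hPcop hN.symm hr0
  have hint : ∀ m : Fin (n + 1) → ℕ, ∃ z : ℤ, m ∈ evenIndices (n + 1) N →
      d * ∏ i, cothCoeff (m i) = z := by
    intro m
    by_cases hm : m ∈ evenIndices (n + 1) N
    · obtain ⟨z, hz⟩ := hc.exists_int_cothCoeff (m := m) (by
        simpa using (Finset.mem_filter.1 hm).1)
      exact ⟨z, fun _ => hz⟩
    · exact ⟨0, fun h => absurd h hm⟩
  choose z hz using hint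
  obtain ⟨a, ha⟩ := exists_int_eq_of_mem_rationalsAt (d * dedekindCoeff q P r) (by
    intro ℓ hℓ
    by_cases hℓq : ℓ ∣ q
    · have h1 := mul_mem (natCast_mem (rationalsAt hℓ) q) (hcong hℓ hℓq)
      rw [mul_div_cancel₀ _ hqQ] at h1
      have h2 : ∑ m ∈ evenIndices (n + 1) N, (d * ∏ i, cothCoeff (m i)) *
          ∏ i, shiftedBinomial (P i) (m i) (r i) ∈ rationalsAt hℓ := by
        refine sum_mem fun m hm => ?_
        rw [hz m hm]
        exact mul_mem (intCast_mem _ _) (prod_mem fun i _ =>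
          shiftedBinomial_mem_rationalsAt (hPℓ hℓ hℓq i) _ _)
      simpa using sub_mem h1 h2
    · exact mul_dedekindCoeff_mem_rationalsAt hℓ hc hℓq P hN.symm)
  refine ⟨a, by rw [ha, hDd], fun p' hp' => ?_⟩
  set w : (Fin (n + 1) → ℕ) → Fin (n + 1) → ℤ := fun m i => Ring.choose ((m i : ℤ) - 1) (r i - 1) *
    powWithInverse ((Fin.snoc p (-1) : Fin (n + 1) → ℤ) i)
      ((Fin.snoc p' (-1) : Fin (n + 1) → ℤ) i) ((m i : ℤ) - (r i : ℤ)) with hw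
  have hpp' : ∀ i, (Fin.snoc p (-1) : Fin (n + 1) → ℤ) i *
      (Fin.snoc p' (-1) : Fin (n + 1) → ℤ) i ≡ 1 [ZMOD q] := by
    intro i
    refine Fin.lastCases ?_ (fun i => ?_) i
    · rw [Fin.snoc_last, Fin.snoc_last]
      rfl
    · rw [Fin.snoc_castSucc, Fin.snoc_castSucc]
      exact hp' i
  have hb : ((∑ m ∈ evenIndices (n + 1) N, -(z m * ∏ i, w m i) : ℤ) : ℚ) =
      ∑ m ∈ evenIndices (n + 1) N, (-d) * (∏ i, bernoulli (m i) / ((m i).factorial : ℚ)) *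
        ∏ i, ((w m i : ℤ) : ℚ) := by
    push_cast
    refine Finset.sum_congr rfl fun m hm => ?_
    rw [← hz m hm, ← prod_cothCoeff_of_even (Finset.mem_filter.1 hm).2.1]
    ring
  refine ⟨∑ m ∈ evenIndices (n + 1) N, -(z m * ∏ i, w m i), hb, ?_⟩
  -- Divisibility of `b - a` by `q` is checked at each prime. Primes not dividing `q` are automatic;
  -- at the others, `P i ^ e` is replaced by `powWithInverse` modulo `q` in the local congruence.
  obtain ⟨y, hy⟩ := exists_int_eq_of_mem_rationalsAt
    (((∑ m ∈ evenIndices (n + 1) N, -(z m * ∏ i, w m i) : ℤ) - (a : ℚ)) / q) (by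
    intro ℓ hℓ
    by_cases hℓq : ℓ ∣ q
    · have h1 : (∑ m ∈ evenIndices (n + 1) N, (d * ∏ i, cothCoeff (m i)) *
          ((∏ i, shiftedBinomial (P i) (m i) (r i) - ∏ i, ((w m i : ℤ) : ℚ)) / q)) ∈
          rationalsAt hℓ := by
        refine sum_mem fun m hm => ?_
        rw [hz m hm]
        refine mul_mem (intCast_mem _ _) (prod_sub_prod_div_mem _ _ _ _ _
          (fun i => shiftedBinomial_mem_rationalsAt (hPℓ hℓ hℓq i) _ _)
          (fun i => intCast_mem _ _) fun i => ?_)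
        rw [shiftedBinomial, if_neg (hr0 i), hw]
        have h2 := mul_mem (intCast_mem (rationalsAt hℓ)
          (Ring.choose ((m i : ℤ) - 1) (r i - 1)))
          (zpow_sub_powWithInverse_div_mem (hℓ := hℓ) hq (hPℓ hℓ hℓq i) (hPmod i) (hpp' i)
            ((m i : ℤ) - r i))
        convert h2 using 1
        push_cast
        ring
      convert sub_mem h1 (hcong hℓ hℓq) using 1
      rw [ha]
      simp only [mul_sub, sub_div, add_div, Finset.sum_sub_distrib, mul_div_assoc', ← Finset.sum_div]
      push_cast
      rw [Finset.sum_neg_distrib, Finset.sum_congr rfl fun m hm => by rw [← hz m hm]]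
      ring
    · rw [div_eq_mul_inv]
      refine mul_mem (sub_mem (intCast_mem _ _) (intCast_mem _ _)) ?_
      exact_mod_cast inv_mem_rationalsAt (hℓ := hℓ) (b := (q : ℤ))
        fun h => hℓq (Int.natCast_dvd_natCast.1 h))
  rw [Int.modEq_iff_dvd]
  refine ⟨y, ?_⟩
  rw [eq_div_iff hqQ] at hy
  rw [mul_comm]
  exact_mod_cast hy.symm
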